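/- For $n\ge 1$, a height function matrix of order $n$ is an integer matrix $(H_{i,j})_{0\le i,j\le n}$ with $H_{0,k}=H_{k,0}=k$ and $H_{n,k}=H_{k,n}=n-k$ for $0\le k\le n$, in which any two consecutive entries in a row or a column differ by $1$. Ordered entrywise, these matrices form a finite distributive lattice $\mathbf{HFM}_n$ (isomorphic to the lattice of alternating sign matrices of order $n$). For $H\in\mathbf{HFM}_n$, let $J(H)$ be the set of join-irreducible elements $K$ of $\mathbf{HFM}_n$ with $K\le H$. For $\sigma\in\mathfrak S_n$ let $P_\sigma$ be its permutation matrix, $(P_\sigma)_{i,j}=\delta_{\sigma(i),j}$, and let $J(P_\sigma)$ denote $J(H)$ for its height function matrix $H_{i,j}=i+j-2\sum_{i'\le i,\,j'\le j}(P_\sigma)_{i',j'}$. For $\sigma\in\mathfrak S_n$ and $1\le i<j\le n$ such that $\tau=\sigma\circ(i\,j)$ satisfies $\tau<\sigma$ in the (strong) Bruhat order, put $$N_{\sigma,i,j}=J(P_\sigma)\smallsetminus J(P_\tau),$$ the set of join-irreducibles removed by the transposition. Let $N_n$ be the number of distinct sets of the form $N_{\sigma,i,j}$, for all such $\sigma\in\mathfrak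 S_n$ and $i<j$, and let $O_n$ be the number of distinct sets of the form $N_{\sigma,i,j}$ for which moreover $\sigma\circ(i\,j)<\sigma$ is a cover relation of the Bruhat order on $\mathfrak S_n$. Then, as formal power series, $$\sum_{n\ge 1} N_n x^n = \frac{x^2}{(1-x)^4}\sum_{a,b,c,d,e\ge 0}\frac{(a+b+c)!\,(a+d+e)!}{a!\,b!\,c!\,d!\,e!}\,x^{a+b+c+d+e}$$ and $$\sum_{n\ge 1} O_n x^n = \frac{x^2}{(1-x)^4(1-2x)^2}.$$ -/

import Mathlib

/-- A height function matrix of order `n`: an `(n+1) × (n+1)` integer matrix (rows and columns are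
labelled from `0` to `n`) whose first row and column read `0, 1, …, n`, whose last row and column
read `n, …, 1, 0`, and any two consecutive entries of which, in a row or a column, differ by `1`. -/
@[ext] structure HFM (n : ℕ) where
  entry : Matrix (Fin (n + 1)) (Fin (n + 1)) ℤ
  first_row : ∀ j, entry 0 j = (j : ℕ)
  first_col : ∀ i, entry i 0 = (i : ℕ)
  last_row : ∀ j, entry (Fin.last n) j = (n : ℤ) - (j : ℕ)
  last_col : ∀ i, entry i (Fin.last n) = (n : ℤ) - (i : ℕ)
  row_step : ∀ (i : Fin (n + 1)) (j : Fin n), |entry i j.succ - entry i j.castSucc| = 1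
  col_step : ∀ (i : Fin n) (j : Fin (n + 1)), |entry i.succ j - entry i.castSucc j| = 1

namespace HFM

theorem parity {n : ℕ} (H : HFM n) (i j : Fin (n + 1)) :
    (H.entry i j - ((i : ℕ) + (j : ℕ) : ℤ)) % 2 = 0 := by
  induction j using Fin.induction with
  | zero => simp [H.first_col]
  | succ j ih =>
    have h := H.row_step i j
    simp only [Fin.val_succ, Fin.val_castSucc] at ih ⊢
    push_cast
    rcases (abs_eq (by norm_num)).1 h with h | h <;> omega

theorem abs_max_step {a b c d p : ℤ} (h₁ : |b - a| = 1) (h₂ : |d - c| = 1)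
    (ha : (a - p) % 2 = 0) (hc : (c - p) % 2 = 0) : |max b d - max a c| = 1 := by
  rcases (abs_eq (by norm_num)).1 h₁ with h₁ | h₁ <;>
  rcases (abs_eq (by norm_num)).1 h₂ with h₂ | h₂ <;>
  rw [abs_eq (by norm_num)] <;> omega

theorem abs_min_step {a b c d p : ℤ} (h₁ : |b - a| = 1) (h₂ : |d - c| = 1)
    (ha : (a - p) % 2 = 0) (hc : (c - p) % 2 = 0) : |min b d - min a c| = 1 := by
  rcases (abs_eq (by norm_num)).1 h₁ with h₁ | h₁ <;>
  rcases (abs_eq (by norm_num)).1 h₂ with h₂ | h₂ <;>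
  rw [abs_eq (by norm_num)] <;> omega

/-- Height function matrices are compared entrywise. -/
instance instPartialOrder (n : ℕ) : PartialOrder (HFM n) where
  le H K := ∀ i j, H.entry i j ≤ K.entry i j
  le_refl _ _ _ := le_rfl
  le_trans _ _ _ h k i j := (h i j).trans (k i j)
  le_antisymm _ _ h k := HFM.ext (funext fun i => funext fun j => le_antisymm (h i j) (k i j))

/-- The lattice `HFM_n`: joins and meets are the entrywise maxima and minima. -/
instance instLattice (n : ℕ) : Lattice (HFM n) where
  sup H K :=
    { entry := fun i j => max (H.entry i j) (K.entry i j)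
      first_row := fun j => by simp [H.first_row, K.first_row]
      first_col := fun j => by simp [H.first_col, K.first_col]
      last_row := fun j => by simp [H.last_row, K.last_row]
      last_col := fun j => by simp [H.last_col, K.last_col]
      row_step := fun i j =>
        abs_max_step (H.row_step i j) (K.row_step i j) (H.parity _ _) (K.parity _ _)
      col_step := fun i j =>
        abs_max_step (H.col_step i j) (K.col_step i j) (H.parity _ _) (K.parity _ _) }
  inf H K :=
    { entry := fun i j => min (H.entry i j) (K.entry i j)
      first_row := fun j => by simp [H.first_row, K.first_row]
      first_col := fun j => by simp [H.first_col, K.first_col]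
      last_row := fun j => by simp [H.last_row, K.last_row]
      last_col := fun j => by simp [H.last_col, K.last_col]
      row_step := fun i j =>
        abs_min_step (H.row_step i j) (K.row_step i j) (H.parity _ _) (K.parity _ _)
      col_step := fun i j =>
        abs_min_step (H.col_step i j) (K.col_step i j) (H.parity _ _) (K.parity _ _) }
  le_sup_left _ _ _ _ := le_max_left _ _
  le_sup_right _ _ _ _ := le_max_right _ _
  sup_le _ _ _ h k i j := max_le (h i j) (k i j)
  inf_le_left _ _ _ _ := min_le_left _ _
  inf_le_right _ _ _ _ := min_le_right _ _
  le_inf _ _ _ h k i j := le_min (h i j) (k i j)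

/-- `J(H)`: the set of join-irreducible elements of the lattice `HFM_n` that are below `H`. -/
def J {n : ℕ} (H : HFM n) : Set (HFM n) := {K | SupIrred K ∧ K ≤ H}

end HFM

/-- The corner sum matrix `C_{i,j} = ∑_{i' ≤ i, j' ≤ j} A_{i',j'}`, `0 ≤ i, j ≤ n`, of an `n × n`
matrix `A` (rows and columns of `A` are labelled here by `0, …, n-1`, so that the first `i` rows are
those with label less than `i`). -/
def cornerSum {n : ℕ} (A : Matrix (Fin n) (Fin n) ℤ) : Matrix (Fin (n + 1)) (Fin (n + 1)) ℤ :=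
  fun i j => ∑ i' ∈ Finset.univ.filter (fun k : Fin n => k.val < i.val),
    ∑ j' ∈ Finset.univ.filter (fun k : Fin n => k.val < j.val), A i' j'

/-- The height matrix `H_{i,j} = i + j - 2 C_{i,j}` of an `n × n` matrix. -/
def heightMatrix {n : ℕ} (A : Matrix (Fin n) (Fin n) ℤ) : Matrix (Fin (n + 1)) (Fin (n + 1)) ℤ :=
  fun i j => ((i : ℕ) : ℤ) + ((j : ℕ) : ℤ) - 2 * cornerSum A i j

/-- For a permutation matrix the corner sums count the ones in the upper left corner. -/
theorem cornerSum_permMatrix {n : ℕ} (σ : Equiv.Perm (Fin n)) (i j : Fin (n + 1)) :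
    cornerSum (σ.permMatrix ℤ) i j
      = ∑ k : Fin n, if (k : ℕ) < i ∧ (σ k : ℕ) < j then 1 else 0 := by
  unfold cornerSum
  rw [Finset.sum_filter]
  refine Finset.sum_congr rfl fun k _ => ?_
  by_cases hk : (k : ℕ) < i
  · simp [hk, PEquiv.toMatrix_apply, Finset.sum_ite_eq]
  · simp [hk]

theorem heightMatrix_inv {n : ℕ} (σ : Equiv.Perm (Fin n)) (i j : Fin (n + 1)) :
    heightMatrix (σ.permMatrix ℤ) i j = heightMatrix ((σ⁻¹).permMatrix ℤ) j i := by
  unfold heightMatrix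
  rw [cornerSum_permMatrix, cornerSum_permMatrix, ← Equiv.sum_comp σ⁻¹]
  simp only [← Equiv.Perm.mul_apply, mul_inv_cancel, Equiv.Perm.one_apply, and_comm]
  ring

theorem heightMatrix_first_row {n : ℕ} (σ : Equiv.Perm (Fin n)) (j : Fin (n + 1)) :
    heightMatrix (σ.permMatrix ℤ) 0 j = (j : ℕ) := by
  simp [heightMatrix, cornerSum_permMatrix]

theorem heightMatrix_last_col {n : ℕ} (σ : Equiv.Perm (Fin n)) (i : Fin (n + 1)) :
    heightMatrix (σ.permMatrix ℤ) i (Fin.last n) = (n : ℤ) - (i : ℕ) := by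
  have h : (Finset.univ.filter fun k : Fin n => (k : ℕ) < i).card = (i : ℕ) := by
    rw [Fin.card_filter_val_lt]
    have := i.is_lt
    omega
  simp [heightMatrix, cornerSum_permMatrix, h]
  ring

theorem heightMatrix_col_step {n : ℕ} (σ : Equiv.Perm (Fin n)) (i : Fin n) (j : Fin (n + 1)) :
    |heightMatrix (σ.permMatrix ℤ) i.succ j - heightMatrix (σ.permMatrix ℤ) i.castSucc j| = 1 := by
  have h : cornerSum (σ.permMatrix ℤ) i.succ j
      = cornerSum (σ.permMatrix ℤ) i.castSucc j + if (σ i : ℕ) < j then 1 else 0 := by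
    have h' : (if (σ i : ℕ) < j then (1 : ℤ) else 0)
        = ∑ k : Fin n, if k = i then (if (σ k : ℕ) < j then 1 else 0) else 0 := by simp
    rw [cornerSum_permMatrix, cornerSum_permMatrix, h', ← Finset.sum_add_distrib]
    refine Finset.sum_congr rfl fun k _ => ?_
    simp only [Fin.val_succ, Fin.val_castSucc, Fin.ext_iff]
    split_ifs <;> omega
  unfold heightMatrix
  rw [h, abs_eq (by norm_num)]
  simp only [Fin.val_succ, Fin.val_castSucc]
  push_cast
  split_ifs <;> omega

/-- The height function matrix of the permutation matrix `P_σ`, where `(P_σ)_{i,j} = δ_{σ(i),j}`. -/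
def permHFM {n : ℕ} (σ : Equiv.Perm (Fin n)) : HFM n where
  entry := heightMatrix (σ.permMatrix ℤ)
  first_row := heightMatrix_first_row σ
  first_col i := by rw [heightMatrix_inv, heightMatrix_first_row]
  last_row j := by rw [heightMatrix_inv, heightMatrix_last_col]
  last_col := heightMatrix_last_col σ
  row_step i j := by
    rw [heightMatrix_inv, heightMatrix_inv σ i j.castSucc]
    exact heightMatrix_col_step σ⁻¹ j i
  col_step := heightMatrix_col_step σ

/-- The generating relation of the (strong) Bruhat order: `σ = τ ∘ (i j)` with `i < j` and
`τ(i) < τ(j)`, that is, `σ` arises from `τ` by a transposition that increases the length. -/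
def BruhatStep {n : ℕ} (τ σ : Equiv.Perm (Fin n)) : Prop :=
  ∃ i j : Fin n, i < j ∧ τ i < τ j ∧ σ = τ * Equiv.swap i j

/-- The strict (strong) Bruhat order `τ < σ` on the permutations. -/
def BruhatLT {n : ℕ} (τ σ : Equiv.Perm (Fin n)) : Prop := Relation.TransGen BruhatStep τ σ

/-- The cover relation of the (strong) Bruhat order. -/
def BruhatCovBy {n : ℕ} (τ σ : Equiv.Perm (Fin n)) : Prop :=
  BruhatLT τ σ ∧ ∀ ρ, ¬ (BruhatLT τ ρ ∧ BruhatLT ρ σ)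

/-- `N_{σ,i,j} = J(P_σ) ∖ J(P_τ)`, where `τ = σ ∘ (i j)`: the set of join-irreducibles removed by
the transposition `(i j)`. It is only used for `i < j` and `σ ∘ (i j) < σ`. -/
def nappeSet {n : ℕ} (σ : Equiv.Perm (Fin n)) (i j : Fin n) : Set (HFM n) :=
  (permHFM σ).J \ (permHFM (σ * Equiv.swap i j)).J

/-- `N_n`: the number of distinct sets of the form `N_{σ,i,j}` with `σ ∈ 𝔖_n`, `i < j` and
`σ ∘ (i j) < σ`. -/
noncomputable def numN (n : ℕ) : ℕ :=
  Set.ncard {S : Set (HFM n) | ∃ (σ : Equiv.Perm (Fin n)) (i j : Fin n),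
    i < j ∧ BruhatLT (σ * Equiv.swap i j) σ ∧ S = nappeSet σ i j}

/-- `O_n`: the number of those sets for which `σ ∘ (i j) < σ` can be taken to be a cover relation
of the Bruhat order. -/
noncomputable def numO (n : ℕ) : ℕ :=
  Set.ncard {S : Set (HFM n) | ∃ (σ : Equiv.Perm (Fin n)) (i j : Fin n),
    i < j ∧ BruhatCovBy (σ * Equiv.swap i j) σ ∧ S = nappeSet σ i j}

/-- The formal power series
`∑_{a,b,c,d,e ≥ 0} (a+b+c)! (a+d+e)! / (a! b! c! d! e!) x^(a+b+c+d+e)`, through its coefficients: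
that of `x^m` is the sum over the tuples `t = (a,b,c,d,e)` with `a+b+c+d+e = m`. -/
noncomputable def factorialSeries : PowerSeries ℚ :=
  PowerSeries.mk fun m => ∑ t ∈ Finset.Nat.antidiagonalTuple 5 m,
    (((t 0 + t 1 + t 2).factorial : ℚ) * ((t 0 + t 3 + t 4).factorial : ℚ)) /
      (((t 0).factorial : ℚ) * ((t 1).factorial : ℚ) * ((t 2).factorial : ℚ) *
        ((t 3).factorial : ℚ) * ((t 4).factorial : ℚ))

/-!
Write `H_σ` for the height function of a permutation `σ`. The join-irreducible height function
matrices are the *cones*: a cone is the least matrix whose entry at an apex `(p, q)` is at least a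
given height, and it lies below `H` exactly when that height is at most `H p q`
(`HFM.cone_le_iff`, `SupIrred.exists_eq_cone`). Undoing an inversion `(i, j)` of `σ` lowers `H_σ` by
`2` on the rectangle of rows `i < p ≤ j` and columns `σ j < q ≤ σ i`, and changes nothing elsewhere.
So the removed join-irreducibles are the cones whose apex lies on the graph of `H_σ` above this
rectangle (`nappeSet_eq`), and the set of them amounts to the rectangle together with the
restriction of `H_σ` to it.

That restriction is in turn a purely combinatorial datum (`nappeSet_eq_iff`): the number of ones of
the permutation matrix above and to the left of the rectangle, and for each row (column) strictly
between the two rows (columns) of the inversion, whether its one lies to the left or to the right of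
(above or below) the rectangle, or inside it and then where. If the rectangle contains `a` ones, if
`b` and `c` rows have their one to the left and right, and `d` and `e` columns theirs above and
below, then there are `(a+b+c)! (a+d+e)! / (a! b! c! d! e!)` such labellings
(`card_labellings`, `cast_labellingCount`). The four corner blocks of the permutation matrix contain
arbitrary numbers of ones; these four numbers and the labelling determine the position of the
rectangle, and each choice of them is realized by a permutation of the right size
(`exists_perm_of_labels`). Since `n = 2 + (a+b+c+d+e) + (sum of the four corner sizes)`, this gives
the factor `x² / (1-x)⁴` and the factorial series.

By comparison of height functions, `σ ∘ (i j) < σ` in the Bruhat order means that `(i, j)` is an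
inversion, and it is a cover precisely when there is no one inside the rectangle, that is `a = 0`
(`bruhatCovBy_mul_swap_iff`). Then the labels of the rows and those of the columns form arbitrary
words in two letters, which gives `1 / (1-2x)²`.
-/

/-! ### Join-irreducible height function matrices -/

namespace HFM

variable {n : ℕ}

theorem abs_entry_sub_entry_le_row (H : HFM n) (i j j' : Fin (n + 1)) :
    |H.entry i j - H.entry i j'| ≤ |((j : ℕ) : ℤ) - (j' : ℕ)| := by
  have key : ∀ (d : ℕ) (j j' : Fin (n + 1)), (j' : ℕ) = j + d →
      |H.entry i j' - H.entry i j| ≤ d := by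
    intro d
    induction d with
    | zero =>
      intro j j' h
      obtain rfl : j' = j := Fin.ext (by simpa using h)
      simp
    | succ d ih =>
      intro j j' h
      have hj' := j'.isLt
      have h₁ := ih j ⟨j + d, by omega⟩ rfl
      have h₂ := H.row_step i ⟨j + d, by omega⟩
      have e : (⟨j + d, by omega⟩ : Fin n).succ = j' := Fin.ext (by simp [h]; omega)
      rw [e] at h₂
      have h₃ := abs_sub_le (H.entry i j')
        (H.entry i (⟨j + d, by omega⟩ : Fin n).castSucc) (H.entry i j)
      have e' : (⟨j + d, by omega⟩ : Fin n).castSucc = (⟨j + d, by omega⟩ : Fin (n + 1)) := rfl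
      rw [e'] at h₂ h₃
      push_cast
      linarith
  rcases le_total (j : ℕ) (j' : ℕ) with h | h
  · have := key (j' - j) j j' (by omega)
    rw [abs_sub_comm]
    refine this.trans (le_trans (le_of_eq ?_) (neg_le_abs _))
    push_cast [h]
    ring
  · have := key (j - j') j' j (by omega)
    refine this.trans (le_trans (le_of_eq ?_) (le_abs_self _))
    push_cast [h]
    ring

/-- The transpose of a height function matrix. -/
def transpose (H : HFM n) : HFM n where
  entry i j := H.entry j i
  first_row := H.first_col
  first_col := H.first_row
  last_row := H.last_col
  last_col := H.last_row
  row_step i j := H.col_step j i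
  col_step i j := H.row_step j i

/-- A height function matrix is `1`-Lipschitz for the `ℓ¹` distance. -/
theorem entry_le_entry_add (H : HFM n) (i j p q : Fin (n + 1)) :
    H.entry i j ≤ H.entry p q + |((i : ℕ) : ℤ) - (p : ℕ)| + |((j : ℕ) : ℤ) - (q : ℕ)| := by
  have h₁ := H.abs_entry_sub_entry_le_row i j q
  have h₂ := H.transpose.abs_entry_sub_entry_le_row q i p
  have h₃ := (abs_le.1 h₁).2
  have h₄ : H.entry i q - H.entry p q ≤ _ := (abs_le.1 h₂).2
  linarith

theorem abs_sub_le_entry (H : HFM n) (i j : Fin (n + 1)) :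
    |((i : ℕ) : ℤ) - (j : ℕ)| ≤ H.entry i j := by
  have h₁ := H.entry_le_entry_add i 0 i j
  have h₂ := H.entry_le_entry_add 0 j i j
  simp only [first_row, first_col, sub_self, abs_zero, Fin.val_zero, Nat.cast_zero, zero_sub,
    abs_neg, Nat.abs_cast] at h₁ h₂
  rw [abs_le]
  constructor <;> linarith

theorem entry_le_add (H : HFM n) (i j : Fin (n + 1)) :
    H.entry i j ≤ ((i : ℕ) : ℤ) + (j : ℕ) := by
  have h := H.entry_le_entry_add i j i 0
  simpa [first_col] using h

theorem entry_le_sub (H : HFM n) (i j : Fin (n + 1)) :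
    H.entry i j ≤ 2 * (n : ℤ) - (i : ℕ) - (j : ℕ) := by
  have h := H.entry_le_entry_add i j i (Fin.last n)
  have hj := j.is_le
  rw [last_col, abs_of_nonpos (a := ((j : ℕ) : ℤ) - _) (by simp; omega)] at h
  simp at h
  linarith

/-- The smallest height function matrix whose entry at `(p, q)` is at least that of `H`. It depends
only on the apex `(p, q)` and on the height `H p q`; taking the height from a matrix `H` ensures
that it has the right parity and is within the range allowed by the boundary. -/
def cone (H : HFM n) (p q : Fin (n + 1)) : HFM n where
  entry i j := max |((i : ℕ) : ℤ) - (j : ℕ)|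
    (H.entry p q - |((i : ℕ) : ℤ) - (p : ℕ)| - |((j : ℕ) : ℤ) - (q : ℕ)|)
  first_row j := by
    have h := H.entry_le_add p q
    have := j.is_le
    simp only [Fin.val_zero, abs_eq_max_neg]
    omega
  first_col i := by
    have h := H.entry_le_add p q
    have := i.is_le
    simp only [Fin.val_zero, abs_eq_max_neg]
    omega
  last_row j := by
    have h := H.entry_le_sub p q
    have := j.is_le
    simp only [Fin.val_last, abs_eq_max_neg]
    omega
  last_col i := by
    have h := H.entry_le_sub p q
    have := i.is_le
    simp only [Fin.val_last, abs_eq_max_neg]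
    omega
  row_step i j := by
    have h := H.parity p q
    refine abs_max_step (p := (i : ℕ) + (j : ℕ)) ?_ ?_ ?_ ?_ <;>
      simp only [Fin.val_succ, Fin.val_castSucc, abs_eq_max_neg] <;> omega
  col_step i j := by
    have h := H.parity p q
    refine abs_max_step (p := (i : ℕ) + (j : ℕ)) ?_ ?_ ?_ ?_ <;>
      simp only [Fin.val_succ, Fin.val_castSucc, abs_eq_max_neg] <;> omega

theorem cone_entry_self (H : HFM n) (p q : Fin (n + 1)) :
    (H.cone p q).entry p q = H.entry p q := by
  simpa [cone] using H.abs_sub_le_entry p q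

theorem cone_le_iff {H G : HFM n} {p q : Fin (n + 1)} :
    H.cone p q ≤ G ↔ H.entry p q ≤ G.entry p q := by
  constructor
  · intro h
    rw [← H.cone_entry_self p q]
    exact h p q
  · intro h i j
    refine max_le (G.abs_sub_le_entry i j) ?_
    have := G.entry_le_entry_add p q i j
    rw [abs_sub_comm (p : ℤ), abs_sub_comm (q : ℤ)] at this
    linarith

theorem cone_congr {H G : HFM n} {p q : Fin (n + 1)} (h : H.entry p q = G.entry p q) :
    H.cone p q = G.cone p q := by
  ext i j
  simp [cone, h]

theorem supIrred_cone {H G : HFM n} {p q : Fin (n + 1)} (h : G.entry p q < H.entry p q) :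
    SupIrred (H.cone p q) := by
  constructor
  · intro hmin
    have h₁ := hmin (b := G ⊓ H.cone p q) inf_le_right
    have h₂ := cone_le_iff.1 (h₁.trans inf_le_left)
    omega
  · intro A B hAB
    have h₁ : max (A.entry p q) (B.entry p q) = H.entry p q := by
      rw [← H.cone_entry_self p q, ← hAB]
      rfl
    rcases max_choice (A.entry p q) (B.entry p q) with h₂ | h₂
    · left
      exact le_antisymm (hAB ▸ le_sup_left) (cone_le_iff.2 (by omega))
    · right
      exact le_antisymm (hAB ▸ le_sup_right) (cone_le_iff.2 (by omega))

/-- A height function matrix is the join of its cones, so a join-irreducible one is a cone. -/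
theorem _root_.SupIrred.exists_eq_cone {K : HFM n} (hK : SupIrred K) :
    ∃ p q, K = K.cone p q := by
  -- As long as no cone equals `K`, the join of finitely many of them stays strictly below `K`.
  have key : ∀ s : Finset (Fin (n + 1) × Fin (n + 1)),
      (∃ x ∈ s, K = K.cone x.1 x.2) ∨ ∃ G < K, ∀ x ∈ s, K.cone x.1 x.2 ≤ G := by
    intro s
    induction s using Finset.induction with
    | empty =>
      obtain ⟨G, hG⟩ := not_isMin_iff.1 hK.1
      exact Or.inr ⟨G, hG, by simp⟩
    | insert x s _ ih =>
      rcases ih with ⟨y, hy, h⟩ | ⟨G, hG, h⟩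
      · exact Or.inl ⟨y, Finset.mem_insert_of_mem hy, h⟩
      · by_cases hx : K = K.cone x.1 x.2
        · exact Or.inl ⟨x, Finset.mem_insert_self _ _, hx⟩
        · refine Or.inr ⟨G ⊔ K.cone x.1 x.2, lt_of_le_of_ne ?_ ?_, ?_⟩
          · exact sup_le hG.le (cone_le_iff.2 le_rfl)
          · intro he
            rcases hK.2 he with h' | h'
            · exact hG.ne h'
            · exact hx h'.symm
          · intro y hy
            rcases Finset.mem_insert.1 hy with rfl | hy
            · exact le_sup_right
            · exact (h y hy).trans le_sup_left
  rcases key Finset.univ with ⟨x, _, h⟩ | ⟨G, hG, h⟩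
  · exact ⟨x.1, x.2, h⟩
  · exact absurd (fun i j => cone_le_iff.1 (h (i, j) (Finset.mem_univ _))) hG.not_ge

/-- A cone other than the minimum of the lattice determines its apex and its height. -/
theorem cone_injective {H H' G G' : HFM n} {p q p' q' : Fin (n + 1)}
    (h : G.entry p q < H.entry p q) (h' : G'.entry p' q' < H'.entry p' q')
    (e : H.cone p q = H'.cone p' q') :
    p = p' ∧ q = q' ∧ H.entry p q = H'.entry p' q' := by
  have h₁ := congrArg (fun K => HFM.entry K p q) e
  have h₂ := congrArg (fun K => HFM.entry K p' q') e
  simp only [cone_entry_self] at h₁ h₂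
  have h₃ := G.abs_sub_le_entry p q
  have h₄ := G'.abs_sub_le_entry p' q'
  simp only [cone] at h₁ h₂
  rw [Fin.ext_iff, Fin.ext_iff]
  rcases max_choice |((p : ℕ) : ℤ) - (q : ℕ)| (H'.entry p' q' - |((p : ℕ) : ℤ) - (p' : ℕ)| -
    |((q : ℕ) : ℤ) - (q' : ℕ)|) with h₅ | h₅
  · omega
  rcases max_choice |((p' : ℕ) : ℤ) - (q' : ℕ)| (H.entry p q - |((p' : ℕ) : ℤ) - (p : ℕ)| -
    |((q' : ℕ) : ℤ) - (q : ℕ)|) with h₆ | h₆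
  · omega
  rw [h₅] at h₁
  rw [h₆] at h₂
  have a₁ := abs_nonneg (((p : ℕ) : ℤ) - (p' : ℕ))
  have a₂ := abs_nonneg (((q : ℕ) : ℤ) - (q' : ℕ))
  have a₃ := abs_nonneg (((p' : ℕ) : ℤ) - (p : ℕ))
  have a₄ := abs_nonneg (((q' : ℕ) : ℤ) - (q : ℕ))
  have b₁ : |((p : ℕ) : ℤ) - (p' : ℕ)| = 0 := by linarith
  have b₂ : |((q : ℕ) : ℤ) - (q' : ℕ)| = 0 := by linarith
  rw [abs_eq_zero] at b₁ b₂
  refine ⟨by omega, by omega, ?_⟩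
  linarith

end HFM

/-! ### The join-irreducibles removed by a transposition -/

/-- The number of ones of the permutation matrix of `σ` in the first `p` rows and the first `q`
columns. -/
def cornerCount {n : ℕ} (σ : Equiv.Perm (Fin n)) (p q : ℕ) : ℕ :=
  (Finset.univ.filter fun k : Fin n => (k : ℕ) < p ∧ (σ k : ℕ) < q).card

section Corner

variable {n : ℕ} {σ σ' : Equiv.Perm (Fin n)} {i j : Fin n}

theorem permHFM_entry (σ : Equiv.Perm (Fin n)) (p q : Fin (n + 1)) :
    (permHFM σ).entry p q = (p : ℕ) + (q : ℕ) - 2 * (cornerCount σ p q : ℤ) := by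
  simp [permHFM, heightMatrix, cornerSum_permMatrix, cornerCount]

theorem cornerCount_succ_left (σ : Equiv.Perm (Fin n)) (p : Fin n) (q : ℕ) :
    cornerCount σ (p + 1) q = cornerCount σ p q + if (σ p : ℕ) < q then 1 else 0 := by
  have h : (if (σ p : ℕ) < q then 1 else 0)
      = ∑ k : Fin n, if k = p then (if (σ k : ℕ) < q then 1 else 0) else 0 := by simp
  rw [cornerCount, cornerCount, h, Finset.card_filter, Finset.card_filter,
    ← Finset.sum_add_distrib]
  refine Finset.sum_congr rfl fun k _ => ?_
  simp only [Fin.ext_iff]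
  split_ifs <;> omega

theorem cornerCount_inv (σ : Equiv.Perm (Fin n)) (p q : ℕ) :
    cornerCount σ⁻¹ q p = cornerCount σ p q := by
  rw [cornerCount, cornerCount, Finset.card_filter, Finset.card_filter, ← Equiv.sum_comp σ]
  simp [and_comm]

theorem cornerCount_succ_right (σ : Equiv.Perm (Fin n)) (p : ℕ) (q : Fin n) :
    cornerCount σ p (q + 1) = cornerCount σ p q + if (σ⁻¹ q : ℕ) < p then 1 else 0 := by
  rw [← cornerCount_inv, cornerCount_succ_left, cornerCount_inv]

/-- Undoing the inversion `(i, j)` lowers the height function by `2` on a rectangle and leaves it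
unchanged elsewhere. -/
theorem permHFM_mul_swap_entry (hij : i < j) (hσ : σ j < σ i) (p q : Fin (n + 1)) :
    (permHFM σ).entry p q = (permHFM (σ * Equiv.swap i j)).entry p q +
      if ((i : ℕ) < p ∧ (p : ℕ) ≤ j) ∧ (σ j : ℕ) < q ∧ (q : ℕ) ≤ σ i then 2 else 0 := by
  have h : (cornerCount (σ * Equiv.swap i j) p q : ℤ) - cornerCount σ p q
      = if ((i : ℕ) < p ∧ (p : ℕ) ≤ j) ∧ (σ j : ℕ) < q ∧ (q : ℕ) ≤ σ i then 1 else 0 := by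
    have hi : (σ * Equiv.swap i j) i = σ j := by simp
    have hj : (σ * Equiv.swap i j) j = σ i := by simp
    have hk : ∀ k, k ≠ i → k ≠ j → (σ * Equiv.swap i j) k = σ k := fun k h₁ h₂ => by
      simp [Equiv.swap_apply_of_ne_of_ne h₁ h₂]
    generalize σ * Equiv.swap i j = τ at hi hj hk
    rw [cornerCount, cornerCount, Finset.card_filter, Finset.card_filter]
    push_cast
    rw [← Finset.sum_sub_distrib, Finset.sum_eq_add i j hij.ne]
    · rw [hi, hj]
      rw [Fin.lt_def] at hij hσ
      split_ifs <;> omega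
    · rintro k - ⟨h₁, h₂⟩
      rw [hk k h₁ h₂, sub_self]
    · simp
    · simp
  rw [permHFM_entry, permHFM_entry]
  split_ifs at h ⊢ <;> linarith

/-- The join-irreducibles removed when the inversion `(i, j)` is undone are the cones of the height
function with apex in a rectangle. -/
theorem nappeSet_eq (hij : i < j) (hσ : σ j < σ i) :
    nappeSet σ i j = {K | ∃ p q : Fin (n + 1),
      (((i : ℕ) < p ∧ (p : ℕ) ≤ j) ∧ (σ j : ℕ) < q ∧ (q : ℕ) ≤ σ i) ∧
        K = (permHFM σ).cone p q} := by
  ext K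
  simp only [nappeSet, HFM.J, Set.mem_sdiff, Set.mem_ofPred_eq, not_and]
  constructor
  · rintro ⟨⟨hK, h₁⟩, h₂⟩
    obtain ⟨p, q, h⟩ := hK.exists_eq_cone
    have h₃ := h₂ hK
    rw [h, HFM.cone_le_iff] at h₁ h₃
    have h₄ := permHFM_mul_swap_entry hij hσ p q
    have h₅ := (permHFM σ).parity p q
    have h₆ := K.parity p q
    refine ⟨p, q, ?_, h.trans (HFM.cone_congr ?_)⟩
    · by_contra h₇
      rw [if_neg h₇] at h₄
      omega
    · split_ifs at h₄ <;> omega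
  · rintro ⟨p, q, h, rfl⟩
    have h₁ := permHFM_mul_swap_entry hij hσ p q
    rw [if_pos h] at h₁
    have h₂ : (permHFM (σ * Equiv.swap i j)).entry p q < (permHFM σ).entry p q := by omega
    exact ⟨⟨HFM.supIrred_cone h₂, HFM.cone_le_iff.2 le_rfl⟩,
      fun _ => fun h₃ => absurd (HFM.cone_le_iff.1 h₃) (not_le.2 h₂)⟩

theorem exists_cornerCount_eq_of_nappeSet_subset {i' j' : Fin n} (hij : i < j) (hσ : σ j < σ i)
    (hij' : i' < j') (hσ' : σ' j' < σ' i') (h : nappeSet σ i j ⊆ nappeSet σ' i' j') (p q : ℕ)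
    (hp : (i : ℕ) < p ∧ p ≤ j) (hq : (σ j : ℕ) < q ∧ q ≤ σ i) :
    ((i' : ℕ) < p ∧ p ≤ j') ∧ ((σ' j' : ℕ) < q ∧ q ≤ σ' i') ∧
      cornerCount σ p q = cornerCount σ' p q := by
  have hpn : p < n + 1 := by omega
  have hqn : q < n + 1 := by omega
  have hmem : (permHFM σ).cone ⟨p, hpn⟩ ⟨q, hqn⟩ ∈ nappeSet σ i j := by
    rw [nappeSet_eq hij hσ]
    exact ⟨_, _, ⟨hp, hq⟩, rfl⟩
  have hmem' := h hmem
  rw [nappeSet_eq hij' hσ'] at hmem'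
  obtain ⟨p', q', hR, e⟩ := hmem'
  have h₁ := permHFM_mul_swap_entry hij hσ ⟨p, hpn⟩ ⟨q, hqn⟩
  rw [if_pos ⟨hp, hq⟩] at h₁
  have h₂ := permHFM_mul_swap_entry hij' hσ' p' q'
  rw [if_pos hR] at h₂
  obtain ⟨rfl, rfl, h₃⟩ := HFM.cone_injective
    (G := permHFM (σ * Equiv.swap i j)) (G' := permHFM (σ' * Equiv.swap i' j'))
    (by omega) (by omega) e
  rw [permHFM_entry, permHFM_entry] at h₃
  refine ⟨hR.1, hR.2, ?_⟩
  simp only at h₃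
  omega

/-- Two sets of removed join-irreducibles agree precisely when the rectangles agree and the corner
counts agree on them. -/
theorem nappeSet_eq_iff_cornerCount {i' j' : Fin n} (hij : i < j) (hσ : σ j < σ i)
    (hij' : i' < j') (hσ' : σ' j' < σ' i') :
    nappeSet σ i j = nappeSet σ' i' j' ↔ (i = i' ∧ j = j' ∧ σ i = σ' i' ∧ σ j = σ' j') ∧
      ∀ p q : ℕ, ((i : ℕ) < p ∧ p ≤ j) → ((σ j : ℕ) < q ∧ q ≤ σ i) →
        cornerCount σ p q = cornerCount σ' p q := by
  constructor
  · intro h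
    have h₁ := exists_cornerCount_eq_of_nappeSet_subset hij hσ hij' hσ' h.subset
    have h₂ := exists_cornerCount_eq_of_nappeSet_subset hij' hσ' hij hσ h.symm.subset
    refine ⟨?_, fun p q hp hq => (h₁ p q hp hq).2.2⟩
    rw [Fin.lt_def] at hij hσ hij' hσ'
    simp only [Fin.ext_iff]
    have a := h₁ (i + 1) (σ j + 1) (by omega) (by omega)
    have b := h₁ j (σ i) (by omega) (by omega)
    have c := h₂ (i' + 1) (σ' j' + 1) (by omega) (by omega)
    have d := h₂ j' (σ' i') (by omega) (by omega)
    omega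
  · rintro ⟨⟨rfl, rfl, hi, hj⟩, h⟩
    rw [nappeSet_eq hij hσ, nappeSet_eq hij' hσ', ← hi, ← hj]
    ext K
    refine exists_congr fun p => exists_congr fun q => and_congr_right fun hR => ?_
    have : (permHFM σ).entry p q = (permHFM σ').entry p q := by
      rw [permHFM_entry, permHFM_entry, h p q hR.1 hR.2]
    rw [HFM.cone_congr this]

/-- The labels, relative to the rectangle of the inversion `(i, j)`, of the rows strictly between
`i` and `j` and of the columns strictly between `σ j` and `σ i` are the same for `σ` and `σ'`: a row
or column whose one lies inside the rectangle is labelled by its place, any other one by the side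
of the rectangle on which its one lies. -/
structure SameLabels (σ σ' : Equiv.Perm (Fin n)) (i j : Fin n) : Prop where
  row_lt : ∀ k, i < k → k < j → (σ k < σ j ↔ σ' k < σ j)
  row_gt : ∀ k, i < k → k < j → (σ i < σ k ↔ σ i < σ' k)
  col_lt : ∀ k, σ j < k → k < σ i → (σ⁻¹ k < i ↔ σ'⁻¹ k < i)
  col_gt : ∀ k, σ j < k → k < σ i → (j < σ⁻¹ k ↔ j < σ'⁻¹ k)
  inner : ∀ k, i < k → k < j → σ j < σ k → σ k < σ i → σ' k = σ k

theorem SameLabels.cornerCount_eq (h : SameLabels σ σ' i j) (hi : σ i = σ' i) (hj : σ j = σ' j)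
    (h₀ : cornerCount σ i (σ j) = cornerCount σ' i (σ j)) (p q : ℕ)
    (hp : (i : ℕ) < p ∧ p ≤ j) (hq : (σ j : ℕ) < q ∧ q ≤ σ i) :
    cornerCount σ p q = cornerCount σ' p q := by
  obtain ⟨hp, hpj⟩ := hp
  obtain ⟨hq, hqi⟩ := hq
  have hinv : σ'⁻¹ (σ j) = j := by rw [hj]; simp
  have hinv' : σ'⁻¹ (σ i) = i := by rw [hi]; simp
  -- First along the top row of the rectangle, by columns; then downwards, by rows.
  have hbase : ∀ q : ℕ, (σ j : ℕ) + 1 ≤ q → q ≤ σ i →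
      cornerCount σ (i + 1) q = cornerCount σ' (i + 1) q := by
    intro q hq
    induction q, hq using Nat.le_induction with
    | base =>
      intro _
      rw [cornerCount_succ_right, cornerCount_succ_right, cornerCount_succ_left,
        cornerCount_succ_left, h₀, hi, hinv]
      simp
    | succ q hq ih =>
      intro hqi
      have ih := ih (by omega)
      have hqn : q < n := by omega
      have e := cornerCount_succ_right σ (i + 1) ⟨q, hqn⟩
      have e' := cornerCount_succ_right σ' (i + 1) ⟨q, hqn⟩
      have hl := h.col_lt ⟨q, hqn⟩ (Fin.lt_def.2 hq) (Fin.lt_def.2 hqi)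
      have n₁ : σ⁻¹ ⟨q, hqn⟩ ≠ i := by
        intro h
        have := congrArg σ h
        simp [Fin.ext_iff] at this
        omega
      have n₂ : σ'⁻¹ ⟨q, hqn⟩ ≠ i := by
        intro h
        have := congrArg σ' h
        rw [← hi] at this
        simp [Fin.ext_iff] at this
        omega
      rw [Fin.lt_def, Fin.lt_def] at hl
      simp only [Fin.ext_iff, ne_eq] at n₁ n₂ e e' ⊢
      rw [e, e', ih]
      congr 1
      split_ifs <;> omega
  induction p, hp using Nat.le_induction with
  | base => exact hbase q hq hqi
  | succ p hp ih =>
    have ih := ih (by omega)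
    have hpn : p < n := by omega
    have e := cornerCount_succ_left σ ⟨p, hpn⟩ q
    have e' := cornerCount_succ_left σ' ⟨p, hpn⟩ q
    have l₁ := h.row_lt ⟨p, hpn⟩ (Fin.lt_def.2 hp) (Fin.lt_def.2 hpj)
    have l₂ := h.row_gt ⟨p, hpn⟩ (Fin.lt_def.2 hp) (Fin.lt_def.2 hpj)
    have l₃ := h.inner ⟨p, hpn⟩ (Fin.lt_def.2 hp) (Fin.lt_def.2 hpj)
    have n₁ : σ ⟨p, hpn⟩ ≠ σ i := by
      rw [σ.injective.ne_iff, ne_eq, Fin.ext_iff]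
      simp only
      omega
    have n₂ : σ ⟨p, hpn⟩ ≠ σ j := by
      rw [σ.injective.ne_iff, ne_eq, Fin.ext_iff]
      simp only
      omega
    have n₃ : σ' ⟨p, hpn⟩ ≠ σ i := by
      rw [hi, σ'.injective.ne_iff, ne_eq, Fin.ext_iff]
      simp only
      omega
    have n₄ : σ' ⟨p, hpn⟩ ≠ σ j := by
      rw [hj, σ'.injective.ne_iff, ne_eq, Fin.ext_iff]
      simp only
      omega
    simp only [Fin.ext_iff, ne_eq, Fin.lt_def] at *
    rw [e, e', ih]
    congr 1
    split_ifs <;> omega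

theorem sameLabels_of_cornerCount_eq (hij : i < j) (hσ : σ j < σ i)
    (hi : σ i = σ' i) (hj : σ j = σ' j)
    (h : ∀ p q : ℕ, ((i : ℕ) < p ∧ p ≤ j) → ((σ j : ℕ) < q ∧ q ≤ σ i) →
      cornerCount σ p q = cornerCount σ' p q) :
    SameLabels σ σ' i j := by
  have hrow : ∀ k : Fin n, i < k → k < j → ∀ q : ℕ, (σ j : ℕ) < q → q ≤ σ i →
      ((σ k : ℕ) < q ↔ (σ' k : ℕ) < q) := by
    intro k h₁ h₂ q h₃ h₄
    rw [Fin.lt_def] at h₁ h₂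
    have e₁ := h k q ⟨h₁, h₂.le⟩ ⟨h₃, h₄⟩
    have e₂ := h (k + 1) q ⟨by omega, h₂⟩ ⟨h₃, h₄⟩
    rw [cornerCount_succ_left, cornerCount_succ_left, e₁] at e₂
    split_ifs at e₂ <;> omega
  have hcol : ∀ k : Fin n, σ j < k → k < σ i → ∀ p : ℕ, (i : ℕ) < p → p ≤ j →
      ((σ⁻¹ k : ℕ) < p ↔ (σ'⁻¹ k : ℕ) < p) := by
    intro k h₁ h₂ p h₃ h₄
    rw [Fin.lt_def] at h₁ h₂
    have e₁ := h p k ⟨h₃, h₄⟩ ⟨h₁, h₂.le⟩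
    have e₂ := h p (k + 1) ⟨h₃, h₄⟩ ⟨by omega, h₂⟩
    rw [cornerCount_succ_right, cornerCount_succ_right, e₁] at e₂
    split_ifs at e₂ <;> omega
  have hne : ∀ k, i < k → k < j → σ k ≠ σ i ∧ σ k ≠ σ j ∧ σ' k ≠ σ i ∧ σ' k ≠ σ j := by
    intro k h₁ h₂
    rw [hi, hj, σ'.injective.ne_iff, σ'.injective.ne_iff, ← hi, ← hj, σ.injective.ne_iff,
      σ.injective.ne_iff]
    exact ⟨h₁.ne', h₂.ne, h₁.ne', h₂.ne⟩
  have hne' : ∀ k, σ j < k → k < σ i → σ⁻¹ k ≠ i ∧ σ⁻¹ k ≠ j ∧ σ'⁻¹ k ≠ i ∧ σ'⁻¹ k ≠ j := by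
    intro k h₁ h₂
    simp only [ne_eq, Equiv.Perm.inv_eq_iff_eq, ← hi, ← hj]
    exact ⟨h₂.ne, h₁.ne', h₂.ne, h₁.ne'⟩
  refine ⟨?_, ?_, ?_, ?_, ?_⟩
  · intro k h₁ h₂
    have a := hrow k h₁ h₂ (σ j + 1) (by omega) hσ
    have b := hne k h₁ h₂
    simp only [Fin.lt_def, Fin.ext_iff, ne_eq] at *
    omega
  · intro k h₁ h₂
    have a := hrow k h₁ h₂ (σ i) hσ le_rfl
    have b := hne k h₁ h₂
    simp only [Fin.lt_def, Fin.ext_iff, ne_eq] at *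
    omega
  · intro k h₁ h₂
    have a := hcol k h₁ h₂ (i + 1) (by omega) hij
    have b := hne' k h₁ h₂
    simp only [Fin.lt_def, Fin.ext_iff, ne_eq] at *
    omega
  · intro k h₁ h₂
    have a := hcol k h₁ h₂ j hij le_rfl
    have b := hne' k h₁ h₂
    simp only [Fin.lt_def, Fin.ext_iff, ne_eq] at *
    omega
  · intro k h₁ h₂ h₃ h₄
    have a := hrow k h₁ h₂ (σ k) h₃ h₄.le
    have b := hrow k h₁ h₂ (σ k + 1) (Nat.lt_succ_of_lt h₃) h₄
    rw [Fin.ext_iff]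
    omega

/-- Two sets of removed join-irreducibles agree precisely when the rectangles, the numbers of ones
above and to the left of them, and the labels of the rows and columns agree. -/
theorem nappeSet_eq_iff {i' j' : Fin n} (hij : i < j) (hσ : σ j < σ i)
    (hij' : i' < j') (hσ' : σ' j' < σ' i') :
    nappeSet σ i j = nappeSet σ' i' j' ↔ (i = i' ∧ j = j' ∧ σ i = σ' i' ∧ σ j = σ' j') ∧
      cornerCount σ i (σ j) = cornerCount σ' i (σ j) ∧ SameLabels σ σ' i j := by
  rw [nappeSet_eq_iff_cornerCount hij hσ hij' hσ']
  refine and_congr_right ?_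
  rintro ⟨rfl, rfl, hi, hj⟩
  constructor
  · intro h
    refine ⟨?_, sameLabels_of_cornerCount_eq hij hσ hi hj h⟩
    have e := h (i + 1) (σ j + 1) ⟨by omega, hij⟩ ⟨by omega, hσ⟩
    have hinv : σ'⁻¹ (σ j) = j := by rw [hj]; simp
    rw [Fin.lt_def] at hij hσ
    rw [cornerCount_succ_right, cornerCount_succ_right, cornerCount_succ_left,
      cornerCount_succ_left, ← hi, hinv] at e
    simpa using e
  · rintro ⟨h₁, h₂⟩ p q hp hq
    exact h₂.cornerCount_eq hi hj h₁ p q hp hq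

end Corner

/-! ### The Bruhat order -/

section Bruhat

variable {n : ℕ} {σ τ ρ : Equiv.Perm (Fin n)} {i j : Fin n}

theorem permHFM_mul_swap_lt (hij : i < j) (hσ : σ j < σ i) :
    permHFM (σ * Equiv.swap i j) < permHFM σ := by
  rw [lt_iff_le_not_ge]
  constructor
  · intro p q
    have h := permHFM_mul_swap_entry hij hσ p q
    split_ifs at h <;> omega
  · intro hle
    have h := permHFM_mul_swap_entry hij hσ j.castSucc (σ i).castSucc
    have h' := hle j.castSucc (σ i).castSucc
    rw [if_pos ⟨⟨hij, le_rfl⟩, hσ, le_rfl⟩] at h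
    omega

theorem BruhatLT.permHFM_lt (h : BruhatLT τ σ) : permHFM τ < permHFM σ := by
  have step : ∀ {τ σ : Equiv.Perm (Fin n)}, BruhatStep τ σ → permHFM τ < permHFM σ := by
    rintro τ _ ⟨i, j, hij, hτ, rfl⟩
    have h := permHFM_mul_swap_lt (σ := τ * Equiv.swap i j) hij (by simpa using hτ)
    rwa [mul_assoc, Equiv.swap_mul_self, mul_one] at h
  induction h with
  | single h => exact step h
  | tail _ h ih => exact ih.trans (step h)

theorem bruhatStep_mul_swap (hij : i < j) (hσ : σ j < σ i) :
    BruhatStep (σ * Equiv.swap i j) σ :=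
  ⟨i, j, hij, by simpa using hσ, by rw [mul_assoc, Equiv.swap_mul_self, mul_one]⟩

theorem bruhatLT_mul_swap_iff (hij : i < j) :
    BruhatLT (σ * Equiv.swap i j) σ ↔ σ j < σ i := by
  refine ⟨fun h => ?_, fun h => .single (bruhatStep_mul_swap hij h)⟩
  by_contra h'
  have h'' : σ i < σ j := lt_of_le_of_ne (not_lt.1 h') (σ.injective.ne hij.ne)
  have h₁ : BruhatLT σ (σ * Equiv.swap i j) := .single ⟨i, j, hij, h'', rfl⟩
  exact lt_asymm h.permHFM_lt h₁.permHFM_lt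

/-- A permutation whose height function lies between those of `σ * swap i j` and `σ` agrees with `σ`
outside `{i, j}`, provided that there is no one strictly inside the rectangle of `(i, j)`. -/
theorem apply_eq_of_permHFM_le (hij : i < j) (hσ : σ j < σ i)
    (hempty : ∀ k, i < k → k < j → ¬ (σ j < σ k ∧ σ k < σ i))
    (h₁ : permHFM (σ * Equiv.swap i j) ≤ permHFM ρ) (h₂ : permHFM ρ ≤ permHFM σ)
    (k : Fin n) (hki : k ≠ i) (hkj : k ≠ j) : ρ k = σ k := by
  have hout : ∀ p q : ℕ, p ≤ n → q ≤ n →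
      ¬ (((i : ℕ) < p ∧ p ≤ j) ∧ (σ j : ℕ) < q ∧ q ≤ σ i) →
      cornerCount ρ p q = cornerCount σ p q := by
    intro p q hp hq h
    have e := permHFM_mul_swap_entry hij hσ ⟨p, Nat.lt_succ_of_le hp⟩ ⟨q, Nat.lt_succ_of_le hq⟩
    rw [if_neg h, add_zero] at e
    have e₁ := h₁ ⟨p, Nat.lt_succ_of_le hp⟩ ⟨q, Nat.lt_succ_of_le hq⟩
    have e₂ := h₂ ⟨p, Nat.lt_succ_of_le hp⟩ ⟨q, Nat.lt_succ_of_le hq⟩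
    rw [← e] at e₁
    have e₃ := le_antisymm e₂ e₁
    rw [permHFM_entry, permHFM_entry] at e₃
    simp only at e₃
    omega
  -- The corner counts at the rows `k` and `k + 1` tell whether the value at `k` is less than `q`.
  have hiff : ∀ q : ℕ, q ≤ n →
      ¬ (((i : ℕ) < k ∧ k < j) ∧ (σ j : ℕ) < q ∧ q ≤ σ i) →
      ((ρ k : ℕ) < q ↔ (σ k : ℕ) < q) := by
    intro q hq h
    rw [ne_eq, Fin.ext_iff] at hki hkj
    have e₁ := hout k q k.is_lt.le hq (by omega)
    have e₂ := hout (k + 1) q k.is_lt hq (by omega)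
    rw [cornerCount_succ_left, cornerCount_succ_left, e₁] at e₂
    split_ifs at e₂ <;> omega
  have hi : σ k ≠ σ i := σ.injective.ne hki
  have hj : σ k ≠ σ j := σ.injective.ne hkj
  have he := hempty k
  simp only [Fin.ext_iff, Fin.lt_def, ne_eq] at *
  have a := hiff (σ k) (σ k).is_lt.le (by omega)
  have b := hiff (σ k + 1) (σ k).is_lt (by omega)
  omega

/-- Undoing the inversion `(i, j)` is a cover of the Bruhat order precisely when there is no one
strictly inside the rectangle of `(i, j)`. -/
theorem bruhatCovBy_mul_swap_iff (hij : i < j) :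
    BruhatCovBy (σ * Equiv.swap i j) σ ↔
      σ j < σ i ∧ ∀ k, i < k → k < j → ¬ (σ j < σ k ∧ σ k < σ i) := by
  rw [BruhatCovBy, bruhatLT_mul_swap_iff hij]
  refine and_congr_right fun hσ => ⟨?_, ?_⟩
  · -- A one inside the rectangle factors the transposition through `σ * swap i k`.
    rintro h k hik hkj ⟨h₁, h₂⟩
    refine h (σ * Equiv.swap i k) ⟨?_, .single (bruhatStep_mul_swap hik h₂)⟩
    have e : σ * Equiv.swap i j
        = σ * Equiv.swap i k * Equiv.swap k j * Equiv.swap i k := by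
      rw [mul_assoc, mul_assoc, ← mul_assoc (Equiv.swap i k), Equiv.swap_comm i k,
        Equiv.swap_comm k j, Equiv.swap_mul_swap_mul_swap hkj.ne' hij.ne']
    have v₁ : (σ * Equiv.swap i k) k = σ i := by simp
    have v₂ : (σ * Equiv.swap i k) j = σ j := by
      simp [Equiv.swap_apply_of_ne_of_ne hij.ne' hkj.ne']
    have v₃ : (σ * Equiv.swap i k * Equiv.swap k j) i = σ k := by
      simp [Equiv.swap_apply_of_ne_of_ne hik.ne hij.ne]
    have v₄ : (σ * Equiv.swap i k * Equiv.swap k j) k = σ j := by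
      rw [Equiv.Perm.mul_apply, Equiv.swap_apply_left, v₂]
    rw [e]
    refine Relation.TransGen.trans (b := σ * Equiv.swap i k * Equiv.swap k j)
      (.single (bruhatStep_mul_swap hik ?_)) (.single (bruhatStep_mul_swap hkj ?_))
    · rw [v₃, v₄]
      exact h₁
    · rw [v₁, v₂]
      exact hσ
  · rintro hempty ρ ⟨h₁, h₂⟩
    have hρ := apply_eq_of_permHFM_le hij hσ hempty h₁.permHFM_lt.le h₂.permHFM_lt.le
    have hval : ρ i = σ i ∨ ρ i = σ j := by
      by_contra! hne
      have e := hρ (σ⁻¹ (ρ i)) (by rw [ne_eq, Equiv.Perm.inv_eq_iff_eq]; exact hne.1)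
        (by rw [ne_eq, Equiv.Perm.inv_eq_iff_eq]; exact hne.2)
      have e' : σ⁻¹ (ρ i) = i := ρ.injective (by rw [e]; simp)
      rw [Equiv.Perm.inv_eq_iff_eq] at e'
      exact hne.1 e'
    have hval' : ρ j = σ i ∨ ρ j = σ j := by
      by_contra! hne
      have e := hρ (σ⁻¹ (ρ j)) (by rw [ne_eq, Equiv.Perm.inv_eq_iff_eq]; exact hne.1)
        (by rw [ne_eq, Equiv.Perm.inv_eq_iff_eq]; exact hne.2)
      have e' : σ⁻¹ (ρ j) = j := ρ.injective (by rw [e]; simp)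
      rw [Equiv.Perm.inv_eq_iff_eq] at e'
      exact hne.2 e'
    have hne : ρ i ≠ ρ j := ρ.injective.ne hij.ne
    rcases hval with hi | hi
    · have hj : ρ j = σ j := hval'.resolve_left (by rw [← hi]; exact hne.symm)
      refine h₂.permHFM_lt.ne (congrArg permHFM (Equiv.ext fun k => ?_))
      by_cases hki : k = i
      · rw [hki, hi]
      by_cases hkj : k = j
      · rw [hkj, hj]
      exact hρ k hki hkj
    · have hj : ρ j = σ i := hval'.resolve_right (by rw [← hi]; exact hne.symm)
      refine h₁.permHFM_lt.ne (congrArg permHFM (Equiv.ext fun k => ?_))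
      by_cases hki : k = i
      · simp [hki, hi]
      by_cases hkj : k = j
      · simp [hkj, hj]
      rw [hρ k hki hkj]
      simp [Equiv.swap_apply_of_ne_of_ne hki hkj]

end Bruhat

/-! ### Realizing labels by a permutation -/

section Realization

variable {n : ℕ}

theorem Fin.card_filter_of_iff_interval {P : Fin n → Prop} [DecidablePred P] {a b : ℕ}
    (hb : b ≤ n) (h : ∀ k, P k ↔ a ≤ (k : ℕ) ∧ (k : ℕ) < b) :
    (Finset.univ.filter P).card = b - a := by
  rw [← Nat.card_Ico, ← Finset.card_map Fin.valEmbedding]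
  congr 1
  ext x
  simp only [Finset.mem_map, Finset.mem_filter, Finset.mem_univ, true_and, h,
    Fin.valEmbedding_apply, Finset.mem_Ico]
  exact ⟨fun ⟨k, hk, e⟩ => e ▸ hk, fun hx => ⟨⟨x, by omega⟩, hx, rfl⟩⟩

/-- Two labellings of a finite type whose fibres have the same sizes differ by a permutation, which
may be prescribed on one of the fibres. -/
theorem exists_perm_of_card_fiber_eq {α ι : Type*} [Fintype α] [DecidableEq ι] (ρ κ : α → ι)
    (h : ∀ x, (Finset.univ.filter fun p => ρ p = x).card
      = (Finset.univ.filter fun q => κ q = x).card)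
    (x₀ : ι) (e : {p // ρ p = x₀} ≃ {q // κ q = x₀}) :
    ∃ σ : Equiv.Perm α, (∀ p, κ (σ p) = ρ p) ∧ ∀ p (hp : ρ p = x₀), σ p = e ⟨p, hp⟩ := by
  have E : ∀ x, {p // ρ p = x} ≃ {q // κ q = x} := fun x =>
    Fintype.equivOfCardEq (by rw [Fintype.card_subtype, Fintype.card_subtype, h])
  refine ⟨Equiv.ofFiberEquiv (Function.update E x₀ e), Equiv.ofFiberEquiv_map _, ?_⟩
  rintro p rfl
  change ((Function.update E (ρ p) e (ρ p) ⟨p, rfl⟩ : {q // κ q = ρ p}) : α) = _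
  rw [Function.update_self]

/-- The five zones into which two positions `i < j` divide the line: before `i`, at `i`, between,
at `j`, after `j`. -/
def zone (i j p : Fin n) : Fin 5 :=
  if p < i then 0 else if p = i then 1 else if p < j then 2 else if p = j then 3 else 4

section Zone

variable {i j p : Fin n}

theorem zone_eq_zero : zone i j p = 0 ↔ p < i := by
  grind [zone]

theorem zone_eq_one : zone i j p = 1 ↔ p = i := by
  grind [zone]

theorem zone_eq_three (hij : i < j) : zone i j p = 3 ↔ p = j := by
  grind [zone]

theorem zone_eq_four (hij : i < j) : zone i j p = 4 ↔ j < p := by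
  grind [zone]

end Zone

/-- The zone in which the one of the row `p` is to be placed: outside the interval from `i` to `j`
the zones are filled in increasing order, with `x₁` and `x₂` (above), `y₁` and `y₂` (below) rows in
the first two of them; between `i` and `j`, the set `L` goes to the left and `R` to the right. The
rows `i` and `j` themselves go to the right and left sides of the rectangle, as they form an
inversion. With the roles of rows and columns exchanged, this also gives the zone in which the one
of a column is to be placed. -/
def targetZone (i j : Fin n) (x₁ x₂ y₁ y₂ : ℕ) (L R : Finset (Fin n)) (p : Fin n) : Fin 5 :=
  if p < i then (if (p : ℕ) < x₁ then 0 else if (p : ℕ) < x₁ + x₂ then 2 else 4)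
  else if p = i then 3
  else if p < j then (if p ∈ L then 0 else if p ∈ R then 4 else 2)
  else if p = j then 1
  else (if (p : ℕ) < j + 1 + y₁ then 0 else if (p : ℕ) < j + 1 + y₁ + y₂ then 2 else 4)

/-- The numbers of rows of `targetZone` in each zone with each target. -/
def zoneCard (x₁ x₂ x₃ y₁ y₂ y₃ z₁ z₂ z₃ : ℕ) : Matrix (Fin 5) (Fin 5) ℕ :=
  !![x₁, 0, x₂, 0, x₃; 0, 0, 0, 1, 0; z₁, 0, z₂, 0, z₃; 0, 1, 0, 0, 0; y₁, 0, y₂, 0, y₃]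

theorem card_filter_zone_targetZone {i j : Fin n} (hij : i < j) {x₁ x₂ x₃ y₁ y₂ y₃ z₂ : ℕ}
    {L R : Finset (Fin n)} (hL : ∀ p ∈ L, i < p ∧ p < j) (hR : ∀ p ∈ R, i < p ∧ p < j)
    (hLR : Disjoint L R) (hx : (i : ℕ) = x₁ + x₂ + x₃) (hy : n = j + 1 + y₁ + y₂ + y₃)
    (hz : (Finset.univ.filter fun p => i < p ∧ p < j ∧ p ∉ L ∧ p ∉ R).card = z₂) (x y : Fin 5) :
    (Finset.univ.filter fun p => (zone i j p, targetZone i j x₁ x₂ y₁ y₂ L R p) = (x, y)).card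
      = zoneCard x₁ x₂ x₃ y₁ y₂ y₃ L.card z₂ R.card x y := by
  have hjn := j.is_lt
  have hlr : ∀ p ∈ L, p ∉ R := fun p h => Finset.disjoint_left.1 hLR h
  have empty : ∀ {P : Fin n → Prop} [DecidablePred P], (∀ p, ¬ P p) →
      (Finset.univ.filter P).card = 0 := by
    intro P _ h
    simp [h]
  simp only [Prod.mk.injEq]
  fin_cases x <;> fin_cases y <;>
    first
    | exact empty (by intro p; simp [zone, targetZone]; grind)
    | skip
  · exact (Fin.card_filter_of_iff_interval (a := 0) (b := x₁) (by omega)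
      (by intro p; simp [zone, targetZone]; grind)).trans (by simp [zoneCard])
  · exact (Fin.card_filter_of_iff_interval (a := x₁) (b := x₁ + x₂) (by omega)
      (by intro p; simp [zone, targetZone]; grind)).trans (by simp [zoneCard])
  · exact (Fin.card_filter_of_iff_interval (a := x₁ + x₂) (b := i) (by omega)
      (by intro p; simp [zone, targetZone]; grind)).trans (by simp [zoneCard]; omega)
  · exact (Fin.card_filter_of_iff_interval (a := i) (b := i + 1) (by omega)
      (by intro p; simp [zone, targetZone]; grind)).trans (by simp [zoneCard])
  · refine congrArg Finset.card (a₂ := L) ?_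
    ext p
    simp [zone, targetZone]
    grind
  · refine Eq.trans (congrArg Finset.card ?_) hz
    ext p
    simp [zone, targetZone]
    grind
  · refine congrArg Finset.card (a₂ := R) ?_
    ext p
    simp [zone, targetZone]
    grind
  · exact (Fin.card_filter_of_iff_interval (a := j) (b := j + 1) (by omega)
      (by intro p; simp [zone, targetZone]; grind)).trans (by simp [zoneCard])
  · exact (Fin.card_filter_of_iff_interval (a := j + 1) (b := j + 1 + y₁) (by omega)
      (by intro p; simp [zone, targetZone]; grind)).trans (by simp [zoneCard])
  · exact (Fin.card_filter_of_iff_interval (a := j + 1 + y₁) (b := j + 1 + y₁ + y₂) (by omega)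
      (by intro p; simp [zone, targetZone]; grind)).trans (by simp [zoneCard])
  · exact (Fin.card_filter_of_iff_interval (a := j + 1 + y₁ + y₂) (b := n) (by omega)
      (by intro p; simp [zone, targetZone]; grind)).trans (by simp [zoneCard]; omega)

theorem zoneCard_swap (x₁ x₂ x₃ y₁ y₂ y₃ z₁ z₂ z₃ : ℕ) (x y : Fin 5) :
    zoneCard x₁ x₂ x₃ y₁ y₂ y₃ z₁ z₂ z₃ x y = zoneCard x₁ z₁ y₁ x₃ z₃ y₃ x₂ z₂ y₂ y x := by
  fin_cases x <;> fin_cases y <;> simp [zoneCard]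

/-- The rows between those of the inversion `(i, j)` whose one lies to the left of its
rectangle. -/
def leftRows (σ : Equiv.Perm (Fin n)) (i j : Fin n) : Finset (Fin n) :=
  Finset.univ.filter fun k => (i < k ∧ k < j) ∧ σ k < σ j

/-- The rows between those of the inversion `(i, j)` whose one lies to the right of its
rectangle. -/
def rightRows (σ : Equiv.Perm (Fin n)) (i j : Fin n) : Finset (Fin n) :=
  Finset.univ.filter fun k => (i < k ∧ k < j) ∧ σ i < σ k

/-- The rows whose one lies strictly inside the rectangle of the inversion `(i, j)`. -/
def innerRows (σ : Equiv.Perm (Fin n)) (i j : Fin n) : Finset (Fin n) :=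
  Finset.univ.filter fun k => (i < k ∧ k < j) ∧ σ j < σ k ∧ σ k < σ i

/-- Any choice of labels of the rows and columns of a rectangle comes from a permutation, with a
prescribed number `x₁` of ones above and to the left of the rectangle, as soon as the sizes of the
blocks around the rectangle are compatible with its position. -/
theorem exists_perm_of_labels {i j c d : Fin n} (hij : i < j) (hcd : c < d)
    {L R U D : Finset (Fin n)} (hL : L ⊆ Finset.Ioo i j) (hR : R ⊆ Finset.Ioo i j)
    (hLR : Disjoint L R) (hU : U ⊆ Finset.Ioo c d) (hD : D ⊆ Finset.Ioo c d)
    (hUD : Disjoint U D)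
    (e : {p // p ∈ (Finset.Ioo i j \ L) \ R} ≃ {q // q ∈ (Finset.Ioo c d \ U) \ D})
    {x₁ x₃ y₁ y₃ : ℕ} (hi : (i : ℕ) = x₁ + U.card + x₃) (hc : (c : ℕ) = x₁ + L.card + y₁)
    (hj : n = j + 1 + y₁ + D.card + y₃) (hd : n = d + 1 + x₃ + R.card + y₃) :
    ∃ σ : Equiv.Perm (Fin n), σ i = d ∧ σ j = c ∧ cornerCount σ i c = x₁ ∧
      leftRows σ i j = L ∧ rightRows σ i j = R ∧ leftRows σ⁻¹ c d = U ∧ rightRows σ⁻¹ c d = D ∧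
      ∀ p (hp : p ∈ (Finset.Ioo i j \ L) \ R), σ p = e ⟨p, hp⟩ := by
  have hL' : ∀ p ∈ L, i < p ∧ p < j := fun p hp => Finset.mem_Ioo.1 (hL hp)
  have hR' : ∀ p ∈ R, i < p ∧ p < j := fun p hp => Finset.mem_Ioo.1 (hR hp)
  have hU' : ∀ p ∈ U, c < p ∧ p < d := fun p hp => Finset.mem_Ioo.1 (hU hp)
  have hD' : ∀ p ∈ D, c < p ∧ p < d := fun p hp => Finset.mem_Ioo.1 (hD hp)
  have hlr : ∀ p ∈ L, p ∉ R := fun p hp => Finset.disjoint_left.1 hLR hp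
  have hud : ∀ p ∈ U, p ∉ D := fun p hp => Finset.disjoint_left.1 hUD hp
  set ρ : Fin n → Fin 5 × Fin 5 :=
    fun p => (zone i j p, targetZone i j x₁ U.card y₁ D.card L R p) with hρ
  set κ : Fin n → Fin 5 × Fin 5 :=
    fun q => (targetZone c d x₁ L.card x₃ R.card U D q, zone c d q) with hκ
  have hρ₀ : ∀ p, ρ p = (2, 2) ↔ p ∈ (Finset.Ioo i j \ L) \ R := by
    intro p
    simp [hρ, zone, targetZone]
    grind
  have hκ₀ : ∀ q, κ q = (2, 2) ↔ q ∈ (Finset.Ioo c d \ U) \ D := by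
    intro q
    simp [hκ, zone, targetZone]
    grind
  have hcard : ((Finset.Ioo c d \ U) \ D).card = ((Finset.Ioo i j \ L) \ R).card := by
    rw [← Fintype.card_coe, ← Fintype.card_coe]
    exact Fintype.card_congr e.symm
  obtain ⟨σ, h₁, h₂⟩ := exists_perm_of_card_fiber_eq ρ κ (by
      rintro ⟨x, y⟩
      have a := card_filter_zone_targetZone hij hL' hR' hLR hi hj
        (z₂ := ((Finset.Ioo i j \ L) \ R).card)
        (congrArg Finset.card (by ext p; simp; tauto)) x y
      have b := card_filter_zone_targetZone hcd hU' hD' hUD hc hd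
        (z₂ := ((Finset.Ioo i j \ L) \ R).card)
        (Eq.trans (congrArg Finset.card (by ext p; simp; tauto)) hcard) y x
      rw [zoneCard_swap, ← b] at a
      rw [a]
      simp only [hκ, Prod.mk.injEq, and_comm]) (2, 2)
    ((Equiv.subtypeEquivRight hρ₀).trans (e.trans (Equiv.subtypeEquivRight hκ₀).symm))
  have hz : ∀ p, zone c d (σ p) = targetZone i j x₁ U.card y₁ D.card L R p :=
    fun p => congrArg Prod.snd (h₁ p)
  have hz' : ∀ p, targetZone c d x₁ L.card x₃ R.card U D (σ p) = zone i j p :=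
    fun p => congrArg Prod.fst (h₁ p)
  have hσi : σ i = d := by
    rw [← zone_eq_three hcd, hz]
    simp [targetZone]
  have hσj : σ j = c := by
    rw [← zone_eq_one (j := d), hz]
    simp [targetZone, hij.not_gt, hij.ne']
  have hinv : ∀ k, σ⁻¹ (σ k) = k := fun k => by simp
  refine ⟨σ, hσi, hσj, ?_, ?_, ?_, ?_, ?_, ?_⟩
  · rw [cornerCount, Fin.card_filter_of_iff_interval (a := 0) (b := x₁) (by omega), Nat.sub_zero]
    intro k
    rw [← Fin.lt_def, ← Fin.lt_def, ← zone_eq_zero (p := σ k) (j := d), hz]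
    simp [targetZone]
    grind
  · ext k
    simp only [leftRows, Finset.mem_filter, Finset.mem_univ, true_and, hσj]
    rw [← zone_eq_zero (p := σ k) (j := d), hz]
    simp [targetZone]
    grind
  · ext k
    simp only [rightRows, Finset.mem_filter, Finset.mem_univ, true_and, hσi]
    rw [← zone_eq_four hcd, hz]
    simp [targetZone]
    grind
  · ext q
    obtain ⟨k, rfl⟩ := σ.surjective q
    simp only [leftRows, Finset.mem_filter, Finset.mem_univ, true_and, ← hσi,
      hinv]
    rw [← zone_eq_zero (p := k) (j := j), ← hz']
    simp [targetZone]
    grind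
  · ext q
    obtain ⟨k, rfl⟩ := σ.surjective q
    simp only [rightRows, Finset.mem_filter, Finset.mem_univ, true_and, ← hσj,
      hinv]
    rw [← zone_eq_four hij, ← hz']
    simp [targetZone]
    grind
  · intro p hp
    exact h₂ p ((hρ₀ p).2 hp)

end Realization

/-! ### Block sizes and labellings -/

section Counting

variable {n : ℕ} {σ σ' : Equiv.Perm (Fin n)} {i j : Fin n}

/-- No row strictly between those of the inversion has its one in one of the two columns of the
inversion, so the rows without a side label are the inner ones. -/
theorem mem_sdiff_leftRows_sdiff_rightRows {k : Fin n} :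
    k ∈ (Finset.Ioo i j \ leftRows σ i j) \ rightRows σ i j ↔ k ∈ innerRows σ i j := by
  have h₁ : i < k → σ k ≠ σ i := fun h => σ.injective.ne h.ne'
  have h₂ : k < j → σ k ≠ σ j := fun h => σ.injective.ne h.ne
  simp only [leftRows, rightRows, innerRows, Finset.mem_sdiff, Finset.mem_Ioo, Finset.mem_filter,
    Finset.mem_univ, true_and]
  grind

theorem mem_innerRows_inv {k : Fin n} :
    σ k ∈ innerRows σ⁻¹ (σ j) (σ i) ↔ k ∈ innerRows σ i j := by
  simp [innerRows]
  tauto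

theorem sameLabels_iff (hi : σ i = σ' i) (hj : σ j = σ' j) :
    SameLabels σ σ' i j ↔ leftRows σ i j = leftRows σ' i j ∧ rightRows σ i j = rightRows σ' i j ∧
      leftRows σ⁻¹ (σ j) (σ i) = leftRows σ'⁻¹ (σ j) (σ i) ∧
      rightRows σ⁻¹ (σ j) (σ i) = rightRows σ'⁻¹ (σ j) (σ i) ∧
      ∀ k ∈ innerRows σ i j, σ' k = σ k := by
  have hi' : σ'⁻¹ (σ i) = i := by rw [hi]; simp
  have hj' : σ'⁻¹ (σ j) = j := by rw [hj]; simp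
  simp only [Finset.ext_iff, leftRows, rightRows, innerRows, Finset.mem_filter, Finset.mem_univ,
    true_and, ← hi, ← hj, hi', hj']
  have e : ∀ k, σ⁻¹ (σ k) = k := by simp
  simp only [e]
  constructor
  · rintro ⟨h₁, h₂, h₃, h₄, h₅⟩
    grind
  · rintro ⟨h₁, h₂, h₃, h₄, h₅⟩
    constructor <;> grind

/-- The numbers of ones in the nine blocks into which the inversion `(i, j)` divides the permutation
matrix of `σ`. First come the rectangle and the blocks to its left, to its right, above and below
it, then the four corners: upper left, upper right, lower left, lower right. -/
def blockSizes (σ : Equiv.Perm (Fin n)) (i j : Fin n) : (Fin 5 → ℕ) × (Fin 4 → ℕ) :=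
  (![(innerRows σ i j).card, (leftRows σ i j).card, (rightRows σ i j).card,
      (leftRows σ⁻¹ (σ j) (σ i)).card, (rightRows σ⁻¹ (σ j) (σ i)).card],
    ![cornerCount σ i (σ j), (Finset.univ.filter fun k => k < i ∧ σ i < σ k).card,
      (Finset.univ.filter fun k => j < k ∧ σ k < σ j).card,
      (Finset.univ.filter fun k => j < k ∧ σ i < σ k).card])

/-- The position of an inversion is determined by the block sizes. -/
theorem blockSizes_eq (hij : i < j) (hσ : σ j < σ i) {u : Fin 5 → ℕ} {v : Fin 4 → ℕ}
    (h : blockSizes σ i j = (u, v)) :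
    (i : ℕ) = v 0 + u 3 + v 1 ∧ (j : ℕ) = i + 1 + (u 0 + u 1 + u 2) ∧
      (σ j : ℕ) = v 0 + u 1 + v 2 ∧ (σ i : ℕ) = σ j + 1 + (u 0 + u 3 + u 4) ∧
      n = j + 1 + (v 2 + u 4 + v 3) := by
  obtain ⟨rfl, rfl⟩ := Prod.mk.inj h
  simp only [Matrix.cons_val, Matrix.cons_val_zero, Matrix.cons_val_one]
  have hne : ∀ k, (σ k = σ i ↔ k = i) ∧ (σ k = σ j ↔ k = j) := fun k => by
    simp [σ.injective.eq_iff]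
  have hinv : ∀ k, σ⁻¹ (σ k) = k := by simp
  have card_inv : ∀ (P : Fin n → Prop) [DecidablePred P],
      (Finset.univ.filter P).card = ∑ k, if P (σ k) then 1 else 0 := by
    intro P _
    rw [Finset.card_filter, ← Equiv.sum_comp σ]
  have e₁ : (i : ℕ) = ∑ k : Fin n, if k < i then 1 else 0 := by
    rw [← Finset.card_filter, Finset.filter_gt_eq_Iio, Fin.card_Iio]
  have e₂ : (j : ℕ) - i - 1 = ∑ k : Fin n, if i < k ∧ k < j then 1 else 0 := by
    rw [← Finset.card_filter, ← Fin.card_Ioo]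
    congr 1
    ext k
    simp
  have e₃ : n - 1 - j = ∑ k : Fin n, if j < k then 1 else 0 := by
    rw [← Finset.card_filter, Finset.filter_lt_eq_Ioi, Fin.card_Ioi]
  have e₄ : (σ j : ℕ) = ∑ k : Fin n, if σ k < σ j then 1 else 0 := by
    rw [← card_inv (fun k => k < σ j), Finset.filter_gt_eq_Iio, Fin.card_Iio]
  have e₅ : (σ i : ℕ) - σ j - 1 = ∑ k : Fin n, if σ j < σ k ∧ σ k < σ i then 1 else 0 := by
    rw [← card_inv (fun k => σ j < k ∧ k < σ i), ← Fin.card_Ioo]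
    congr 1
    ext k
    simp
  have f₁ : (leftRows σ⁻¹ (σ j) (σ i)).card
      = ∑ k : Fin n, if k < i ∧ σ j < σ k ∧ σ k < σ i then 1 else 0 := by
    rw [leftRows, card_inv]
    simp [hinv, and_comm]
  have f₂ : (rightRows σ⁻¹ (σ j) (σ i)).card
      = ∑ k : Fin n, if j < k ∧ σ j < σ k ∧ σ k < σ i then 1 else 0 := by
    rw [rightRows, card_inv]
    simp [hinv, and_comm]
  have f₃ : cornerCount σ i (σ j) = ∑ k : Fin n, if k < i ∧ σ k < σ j then 1 else 0 := by
    rw [cornerCount, Finset.card_filter]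
    rfl
  rw [f₁, f₂, f₃, leftRows, rightRows, innerRows]
  simp only [Finset.card_filter]
  -- Each of the three bands of rows and two of those of columns splits into three blocks.
  have g₁ : (i : ℕ) = (∑ k : Fin n, if k < i ∧ σ k < σ j then 1 else 0)
      + (∑ k : Fin n, if k < i ∧ σ j < σ k ∧ σ k < σ i then 1 else 0)
      + ∑ k : Fin n, if k < i ∧ σ i < σ k then 1 else 0 := by
    rw [e₁, ← Finset.sum_add_distrib, ← Finset.sum_add_distrib]
    exact Finset.sum_congr rfl fun k _ => by grind
  have g₂ : (j : ℕ) - i - 1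
      = (∑ k : Fin n, if (i < k ∧ k < j) ∧ σ j < σ k ∧ σ k < σ i then 1 else 0)
      + (∑ k : Fin n, if (i < k ∧ k < j) ∧ σ k < σ j then 1 else 0)
      + ∑ k : Fin n, if (i < k ∧ k < j) ∧ σ i < σ k then 1 else 0 := by
    rw [e₂, ← Finset.sum_add_distrib, ← Finset.sum_add_distrib]
    exact Finset.sum_congr rfl fun k _ => by grind
  have g₃ : n - 1 - j = (∑ k : Fin n, if j < k ∧ σ k < σ j then 1 else 0)
      + (∑ k : Fin n, if j < k ∧ σ j < σ k ∧ σ k < σ i then 1 else 0)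
      + ∑ k : Fin n, if j < k ∧ σ i < σ k then 1 else 0 := by
    rw [e₃, ← Finset.sum_add_distrib, ← Finset.sum_add_distrib]
    exact Finset.sum_congr rfl fun k _ => by grind
  have g₄ : (σ j : ℕ) = (∑ k : Fin n, if k < i ∧ σ k < σ j then 1 else 0)
      + (∑ k : Fin n, if (i < k ∧ k < j) ∧ σ k < σ j then 1 else 0)
      + ∑ k : Fin n, if j < k ∧ σ k < σ j then 1 else 0 := by
    rw [e₄, ← Finset.sum_add_distrib, ← Finset.sum_add_distrib]
    exact Finset.sum_congr rfl fun k _ => by grind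
  have g₅ : (σ i : ℕ) - σ j - 1
      = (∑ k : Fin n, if (i < k ∧ k < j) ∧ σ j < σ k ∧ σ k < σ i then 1 else 0)
      + (∑ k : Fin n, if k < i ∧ σ j < σ k ∧ σ k < σ i then 1 else 0)
      + ∑ k : Fin n, if j < k ∧ σ j < σ k ∧ σ k < σ i then 1 else 0 := by
    rw [e₅, ← Finset.sum_add_distrib, ← Finset.sum_add_distrib]
    exact Finset.sum_congr rfl fun k _ => by grind
  have hjn := j.is_lt
  rw [Fin.lt_def] at hij hσ
  refine ⟨g₁, ?_, g₄, ?_, ?_⟩ <;> omega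

/-- The sizes of the four blocks next to the rectangle and of one corner determine the others, once
the position of the inversion is known. -/
theorem blockSizes_eq_of_card_eq (hij : i < j) (hσ : σ j < σ i) {u : Fin 5 → ℕ} {v : Fin 4 → ℕ}
    (h₁ : (leftRows σ i j).card = u 1) (h₂ : (rightRows σ i j).card = u 2)
    (h₃ : (leftRows σ⁻¹ (σ j) (σ i)).card = u 3) (h₄ : (rightRows σ⁻¹ (σ j) (σ i)).card = u 4)
    (h₀ : cornerCount σ i (σ j) = v 0)
    (h : (i : ℕ) = v 0 + u 3 + v 1 ∧ (j : ℕ) = i + 1 + (u 0 + u 1 + u 2) ∧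
      (σ j : ℕ) = v 0 + u 1 + v 2 ∧ (σ i : ℕ) = σ j + 1 + (u 0 + u 3 + u 4) ∧
      n = j + 1 + (v 2 + u 4 + v 3)) :
    blockSizes σ i j = (u, v) := by
  have b := blockSizes_eq hij hσ (σ := σ) rfl
  rw [Prod.ext_iff]
  simp only [Matrix.cons_val, Matrix.cons_val_zero, Matrix.cons_val_one] at b
  constructor
  · funext x
    fin_cases x <;> simp [blockSizes] <;> omega
  · funext x
    fin_cases x <;> simp [blockSizes] <;> omega

theorem blockSizes_eq_of_nappeSet_eq {i' j' : Fin n} (hij : i < j) (hσ : σ j < σ i)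
    (hij' : i' < j') (hσ' : σ' j' < σ' i') (h : nappeSet σ i j = nappeSet σ' i' j') :
    blockSizes σ i j = blockSizes σ' i' j' := by
  obtain ⟨⟨rfl, rfl, hi, hj⟩, hc, hl⟩ := (nappeSet_eq_iff hij hσ hij' hσ').1 h
  obtain ⟨h₁, h₂, h₃, h₄, -⟩ := (sameLabels_iff hi hj).1 hl
  refine blockSizes_eq_of_card_eq hij hσ (congrArg Finset.card h₁) (congrArg Finset.card h₂)
    ?_ ?_ ?_ (by rw [hi, hj]; exact blockSizes_eq hij hσ' rfl)
  · rw [h₃, hi, hj]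
    rfl
  · rw [h₄, hi, hj]
    rfl
  · rw [hc, hj]
    rfl

/-- The pairs of disjoint subsets of `I` of sizes `b` and `c`. -/
def disjointPairs {α : Type*} [DecidableEq α] (I : Finset α) (b c : ℕ) :
    Finset (Finset α × Finset α) :=
  ((Finset.powersetCard b I) ×ˢ (Finset.powersetCard c I)).filter fun p => Disjoint p.1 p.2

theorem mem_disjointPairs {α : Type*} [DecidableEq α] {I : Finset α} {b c : ℕ}
    {p : Finset α × Finset α} : p ∈ disjointPairs I b c ↔
      ((p.1 ⊆ I ∧ p.1.card = b) ∧ p.2 ⊆ I ∧ p.2.card = c) ∧ Disjoint p.1 p.2 := by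
  simp [disjointPairs, Finset.mem_powersetCard]

theorem card_disjointPairs {α : Type*} [DecidableEq α] (I : Finset α) (b c : ℕ) :
    (disjointPairs I b c).card = I.card.choose b * (I.card - b).choose c := by
  rw [disjointPairs, Finset.card_filter, Finset.sum_product]
  rw [Finset.sum_congr rfl (g := fun _ => (I.card - b).choose c), Finset.sum_const,
    Finset.card_powersetCard, smul_eq_mul]
  intro L hL
  rw [Finset.mem_powersetCard] at hL
  rw [← Finset.card_filter, ← hL.2, ← Finset.card_sdiff_of_subset hL.1,
    ← Finset.card_powersetCard]
  congr 1
  ext R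
  simp only [Finset.mem_filter, Finset.mem_powersetCard, Finset.subset_sdiff]
  rw [disjoint_comm]
  tauto

theorem card_sdiff_sdiff_of_mem_disjointPairs {α : Type*} [DecidableEq α] {I : Finset α}
    {b c : ℕ} {p : Finset α × Finset α} (hp : p ∈ disjointPairs I b c) :
    ((I \ p.1) \ p.2).card = I.card - b - c := by
  obtain ⟨⟨⟨h₁, h₂⟩, h₃, h₄⟩, h⟩ := mem_disjointPairs.1 hp
  rw [Finset.card_sdiff_of_subset (Finset.subset_sdiff.2 ⟨h₃, h.symm⟩),
    Finset.card_sdiff_of_subset h₁, h₂, h₄]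

/-- A labelling of the rows and columns of a rectangle with row set `I` and column set `J`: the rows
with one to the left or to the right, the columns with one above or below, and a bijection between
the other rows and columns. -/
abbrev Labelling {α : Type*} [DecidableEq α] (I J : Finset α) : Type _ :=
  Σ p : (Finset α × Finset α) × (Finset α × Finset α),
    {x // x ∈ (I \ p.1.1) \ p.1.2} ≃ {y // y ∈ (J \ p.2.1) \ p.2.2}

/-- The labellings with given numbers of labels. -/
def labellings {α : Type*} [DecidableEq α] (I J : Finset α) (b c d e : ℕ) :
    Finset (Labelling I J) :=
  (disjointPairs I b c ×ˢ disjointPairs J d e).sigma fun _ => Finset.univ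

theorem card_labellings {α : Type*} [DecidableEq α] {I J : Finset α} {a b c d e : ℕ}
    (hI : I.card = a + b + c) (hJ : J.card = a + d + e) :
    (labellings I J b c d e).card = ((a + b + c).choose b * (a + c).choose c) *
      ((a + d + e).choose d * (a + e).choose e) * a.factorial := by
  rw [labellings, Finset.card_sigma, Finset.sum_congr rfl (g := fun _ => a.factorial),
    Finset.sum_const, Finset.card_product, card_disjointPairs, card_disjointPairs, smul_eq_mul,
    hI, hJ, show a + b + c - b = a + c by omega, show a + d + e - d = a + e by omega]
  intro p hp
  obtain ⟨h₁, h₂⟩ := Finset.mem_product.1 hp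
  have e₁ := card_sdiff_sdiff_of_mem_disjointPairs h₁
  have e₂ := card_sdiff_sdiff_of_mem_disjointPairs h₂
  rw [Finset.card_univ, Fintype.card_equiv (Fintype.equivOfCardEq _), Fintype.card_coe]
  · congr 1
    omega
  · rw [Fintype.card_coe, Fintype.card_coe]
    omega

end Counting

/-! ### Counting the sets with given block sizes -/

section Classes

variable {n : ℕ}

/-- The labelling of the rectangle of an inversion by its permutation. -/
def permLabelling (σ : Equiv.Perm (Fin n)) (i j : Fin n) :
    Labelling (Finset.Ioo i j) (Finset.Ioo (σ j) (σ i)) :=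
  ⟨((leftRows σ i j, rightRows σ i j),
      (leftRows σ⁻¹ (σ j) (σ i), rightRows σ⁻¹ (σ j) (σ i))),
    σ.subtypeEquiv fun k => by
      have h := mem_sdiff_leftRows_sdiff_rightRows (σ := σ⁻¹) (i := σ j) (j := σ i) (k := σ k)
      rw [mem_sdiff_leftRows_sdiff_rightRows, h, mem_innerRows_inv]⟩

theorem permLabelling_mem (σ : Equiv.Perm (Fin n)) {i j : Fin n} (hij : i < j) (hσ : σ j < σ i) :
    permLabelling σ i j ∈ labellings (Finset.Ioo i j) (Finset.Ioo (σ j) (σ i))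
      (leftRows σ i j).card (rightRows σ i j).card
      (leftRows σ⁻¹ (σ j) (σ i)).card (rightRows σ⁻¹ (σ j) (σ i)).card := by
  have aux : ∀ (τ : Equiv.Perm (Fin n)) {x y : Fin n}, τ y < τ x →
      (leftRows τ x y, rightRows τ x y) ∈
        disjointPairs (Finset.Ioo x y) (leftRows τ x y).card (rightRows τ x y).card := by
    intro τ x y h
    rw [mem_disjointPairs, Finset.disjoint_left]
    simp only [leftRows, rightRows, Finset.subset_iff, Finset.mem_filter, Finset.mem_univ,
      true_and, Finset.mem_Ioo]
    grind
  simp only [labellings, Finset.mem_sigma, Finset.mem_univ, and_true, Finset.mem_product]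
  exact ⟨aux σ hσ, aux σ⁻¹ (by simpa using hij)⟩

/-- With the block sizes prescribed, the sets of removed join-irreducibles correspond to the
labellings of a rectangle, and these are easily counted. -/
theorem ncard_nappeSet_blockSizes_eq (u : Fin 5 → ℕ) (v : Fin 4 → ℕ)
    (hn : n = u 0 + u 1 + u 2 + u 3 + u 4 + (v 0 + v 1 + v 2 + v 3) + 2) :
    {S : Set (HFM n) | ∃ (σ : Equiv.Perm (Fin n)) (i j : Fin n),
      i < j ∧ σ j < σ i ∧ blockSizes σ i j = (u, v) ∧ S = nappeSet σ i j}.ncard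
      = ((u 0 + u 1 + u 2).choose (u 1) * (u 0 + u 2).choose (u 2)) *
        ((u 0 + u 3 + u 4).choose (u 3) * (u 0 + u 4).choose (u 4)) * (u 0).factorial := by
  -- The block sizes fix the position of the rectangle.
  obtain ⟨i, hi⟩ : ∃ i : Fin n, (i : ℕ) = v 0 + u 3 + v 1 := ⟨⟨_, by omega⟩, rfl⟩
  obtain ⟨j, hj⟩ : ∃ j : Fin n, (j : ℕ) = i + 1 + (u 0 + u 1 + u 2) := ⟨⟨_, by omega⟩, rfl⟩
  obtain ⟨c, hc⟩ : ∃ c : Fin n, (c : ℕ) = v 0 + u 1 + v 2 := ⟨⟨_, by omega⟩, rfl⟩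
  obtain ⟨d, hd⟩ : ∃ d : Fin n, (d : ℕ) = c + 1 + (u 0 + u 3 + u 4) := ⟨⟨_, by omega⟩, rfl⟩
  have hij : i < j := by rw [Fin.lt_def]; omega
  have hcd : c < d := by rw [Fin.lt_def]; omega
  have real : ∀ l ∈ labellings (Finset.Ioo i j) (Finset.Ioo c d) (u 1) (u 2) (u 3) (u 4),
      ∃ σ : Equiv.Perm (Fin n), σ i = d ∧ σ j = c ∧ cornerCount σ i c = v 0 ∧
      leftRows σ i j = l.1.1.1 ∧ rightRows σ i j = l.1.1.2 ∧
      leftRows σ⁻¹ c d = l.1.2.1 ∧ rightRows σ⁻¹ c d = l.1.2.2 ∧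
      ∀ p (hp : p ∈ (Finset.Ioo i j \ l.1.1.1) \ l.1.1.2), σ p = l.2 ⟨p, hp⟩ := by
    intro l hl
    simp only [labellings, Finset.mem_sigma, Finset.mem_univ, and_true, Finset.mem_product,
      mem_disjointPairs] at hl
    obtain ⟨⟨⟨⟨h₁, h₂⟩, h₃, h₄⟩, h₅⟩, ⟨⟨h₆, h₇⟩, h₈, h₉⟩, h₁₀⟩ := hl
    exact exists_perm_of_labels hij hcd h₁ h₃ h₅ h₆ h₈ h₁₀ l.2 (x₁ := v 0) (x₃ := v 1)
      (y₁ := v 2) (y₃ := v 3) (by omega) (by omega) (by omega) (by omega)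
  -- Each labelling is sent to the set attached to a permutation that realizes it.
  choose! s hs using real
  rw [← card_labellings (I := Finset.Ioo i j) (J := Finset.Ioo c d)
    (by rw [Fin.card_Ioo]; omega) (by rw [Fin.card_Ioo]; omega), ← Set.ncard_coe_finset,
    ← Set.InjOn.ncard_image (f := fun l => nappeSet (s l) i j)]
  · congr 1
    ext S
    simp only [Set.mem_ofPred_eq, Set.mem_image, Finset.mem_coe]
    constructor
    · rintro ⟨σ, i', j', hij', hσ, hb, rfl⟩
      obtain ⟨e₁, e₂, e₃, e₄, -⟩ := blockSizes_eq hij' hσ hb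
      obtain rfl : i' = i := Fin.ext (by omega)
      obtain rfl : j' = j := Fin.ext (by omega)
      obtain rfl : σ j' = c := Fin.ext (by omega)
      obtain rfl : σ i' = d := Fin.ext (by omega)
      obtain ⟨hu, hv⟩ := Prod.mk.inj hb
      have hmem : permLabelling σ i' j' ∈ labellings (Finset.Ioo i' j')
          (Finset.Ioo (σ j') (σ i')) (u 1) (u 2) (u 3) (u 4) := by
        rw [← hu]
        exact permLabelling_mem σ hij hσ
      obtain ⟨h₁, h₂, h₃, h₄, h₅, h₆, h₇, h₈⟩ := hs _ hmem
      refine ⟨permLabelling σ i' j', hmem, ?_⟩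
      rw [nappeSet_eq_iff hij (by rw [h₁, h₂]; exact hσ) hij hσ, sameLabels_iff h₁ h₂, h₁, h₂]
      refine ⟨⟨rfl, rfl, rfl, rfl⟩, ?_, h₄, h₅, h₆, h₇, ?_⟩
      · rw [h₃, ← hv]
        rfl
      · intro k hk
        rw [← mem_sdiff_leftRows_sdiff_rightRows, h₄, h₅] at hk
        exact (h₈ k hk).symm
    · rintro ⟨l, hl, rfl⟩
      obtain ⟨h₁, h₂, h₃, h₄, h₅, h₆, h₇, h₈⟩ := hs l hl
      have hσ : s l j < s l i := by rw [h₁, h₂]; exact hcd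
      refine ⟨s l, i, j, hij, hσ, ?_, rfl⟩
      simp only [labellings, Finset.mem_sigma, Finset.mem_univ, and_true, Finset.mem_product,
        mem_disjointPairs] at hl
      refine blockSizes_eq_of_card_eq hij hσ ?_ ?_ ?_ ?_ ?_ ?_
      · rw [h₄, hl.1.1.1.2]
      · rw [h₅, hl.1.1.2.2]
      · rw [h₁, h₂, h₆, hl.2.1.1.2]
      · rw [h₁, h₂, h₇, hl.2.1.2.2]
      · rw [h₂, h₃]
      · rw [h₁, h₂]
        omega
  · intro l hl l' hl' h
    obtain ⟨h₁, h₂, h₃, h₄, h₅, h₆, h₇, h₈⟩ := hs l hl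
    obtain ⟨h₁', h₂', h₃', h₄', h₅', h₆', h₇', h₈'⟩ := hs l' hl'
    have e₁ : s l i = s l' i := h₁.trans h₁'.symm
    have e₂ : s l j = s l' j := h₂.trans h₂'.symm
    obtain ⟨-, -, h⟩ := (nappeSet_eq_iff hij (by rw [h₁, h₂]; exact hcd) hij
      (by rw [h₁', h₂']; exact hcd)).1 h
    rw [sameLabels_iff e₁ e₂, h₁, h₂, h₄, h₅, h₆, h₇, h₄', h₅', h₆', h₇'] at h
    have hinner : ∀ k ∈ (Finset.Ioo i j \ l.1.1.1) \ l.1.1.2, s l' k = s l k := by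
      rw [← h₄, ← h₅]
      intro k hk
      exact h.2.2.2.2 k (mem_sdiff_leftRows_sdiff_rightRows.1 hk)
    obtain ⟨⟨⟨L, R⟩, U, D⟩, e⟩ := l
    obtain ⟨⟨⟨L', R'⟩, U', D'⟩, e'⟩ := l'
    obtain ⟨rfl, rfl, rfl, rfl, -⟩ := h
    congr 1
    ext ⟨k, hk⟩
    rw [← h₈ k hk, ← h₈' k hk, hinner k hk]

end Classes

/-! ### Generating functions -/

section Series

/-- The number of labellings of a rectangle with `u 0` ones inside it, with `u 1` and `u 2` rows
having their one to its left and right, and with `u 3` and `u 4` columns having their one above and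
below it. -/
def labellingCount (u : Fin 5 → ℕ) : ℕ :=
  ((u 0 + u 1 + u 2).choose (u 1) * (u 0 + u 2).choose (u 2)) *
    ((u 0 + u 3 + u 4).choose (u 3) * (u 0 + u 4).choose (u 4)) * (u 0).factorial

theorem cast_labellingCount (u : Fin 5 → ℕ) : (labellingCount u : ℚ) =
    (((u 0 + u 1 + u 2).factorial : ℚ) * ((u 0 + u 3 + u 4).factorial : ℚ)) /
      (((u 0).factorial : ℚ) * ((u 1).factorial : ℚ) * ((u 2).factorial : ℚ) *
        ((u 3).factorial : ℚ) * ((u 4).factorial : ℚ)) := by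
  have key : ∀ a b c : ℕ, (((a + b + c).choose b * (a + c).choose c : ℕ) : ℚ)
      = (a + b + c).factorial / (a.factorial * b.factorial * c.factorial) := by
    intro a b c
    rw [Nat.cast_mul, show a + b + c = b + (a + c) by ring, Nat.cast_add_choose, add_comm a c,
      Nat.cast_add_choose]
    field_simp
  rw [labellingCount, Nat.cast_mul, Nat.cast_mul, key, key]
  field_simp

/-- The number of sets of removed join-irreducibles for which the block sizes satisfy `Q`, as a sum
over the block sizes. -/
theorem ncard_nappeSet_eq_sum (m : ℕ) (Q : (Fin 5 → ℕ) → Prop) [DecidablePred Q] :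
    {S : Set (HFM (m + 2)) | ∃ (σ : Equiv.Perm (Fin (m + 2))) (i j : Fin (m + 2)),
      i < j ∧ σ j < σ i ∧ Q (blockSizes σ i j).1 ∧ S = nappeSet σ i j}.ncard
      = ∑ p ∈ Finset.HasAntidiagonal.antidiagonal m,
        (∑ u ∈ Finset.Nat.antidiagonalTuple 5 p.1 with Q u, labellingCount u) *
          (Finset.Nat.antidiagonalTuple 4 p.2).card := by
  classical
  set K : ℕ × ℕ → Finset ((Fin 5 → ℕ) × (Fin 4 → ℕ)) := fun p =>
    ((Finset.Nat.antidiagonalTuple 5 p.1).filter Q) ×ˢ Finset.Nat.antidiagonalTuple 4 p.2 with hK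
  set C : (Fin 5 → ℕ) × (Fin 4 → ℕ) → Set (Set (HFM (m + 2))) := fun w =>
    {S | ∃ (σ : Equiv.Perm (Fin (m + 2))) (i j : Fin (m + 2)),
      i < j ∧ σ j < σ i ∧ blockSizes σ i j = (w.1, w.2) ∧ S = nappeSet σ i j} with hC
  have hmem : ∀ p w, w ∈ K p ↔ (w.1 0 + w.1 1 + w.1 2 + w.1 3 + w.1 4 = p.1 ∧ Q w.1) ∧
      w.2 0 + w.2 1 + w.2 2 + w.2 3 = p.2 := by
    intro p w
    simp [hK, Finset.Nat.mem_antidiagonalTuple, Fin.sum_univ_five, Fin.sum_univ_four]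
  have hunion : {S : Set (HFM (m + 2)) | ∃ (σ : Equiv.Perm (Fin (m + 2))) (i j : Fin (m + 2)),
      i < j ∧ σ j < σ i ∧ Q (blockSizes σ i j).1 ∧ S = nappeSet σ i j}
      = ⋃ w ∈ (↑((Finset.HasAntidiagonal.antidiagonal m).biUnion K) :
          Set ((Fin 5 → ℕ) × (Fin 4 → ℕ))), C w := by
    ext S
    simp only [Set.mem_ofPred_eq, Set.mem_iUnion, Finset.mem_coe, Finset.mem_biUnion, hmem, hC,
      exists_prop]
    constructor
    · rintro ⟨σ, i, j, hij, hσ, hQ, rfl⟩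
      obtain ⟨u, v, hb⟩ : ∃ u v, blockSizes σ i j = (u, v) := ⟨_, _, rfl⟩
      have b := blockSizes_eq hij hσ hb
      rw [hb] at hQ
      refine ⟨(u, v), ⟨(_, _), ?_, ⟨rfl, hQ⟩, rfl⟩, σ, i, j, hij, hσ, hb, rfl⟩
      rw [Finset.HasAntidiagonal.mem_antidiagonal]
      simp only
      omega
    · rintro ⟨w, ⟨p, -, ⟨-, hQ⟩, -⟩, σ, i, j, hij, hσ, hb, rfl⟩
      exact ⟨σ, i, j, hij, hσ, by rw [hb]; exact hQ, rfl⟩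
  -- The classes with different block sizes are disjoint, as the set determines the block sizes.
  rw [hunion, Set.Finite.ncard_biUnion (Finset.finite_toSet _), finsum_mem_coe_finset,
    Finset.sum_biUnion]
  · refine Finset.sum_congr rfl fun p hp => ?_
    rw [← smul_eq_mul, Finset.sum_smul, hK, Finset.sum_product]
    refine Finset.sum_congr rfl fun u hu => ?_
    rw [Finset.sum_congr rfl (g := fun _ => labellingCount u), Finset.sum_const, smul_eq_mul,
      smul_eq_mul, mul_comm]
    intro v hv
    have h := (hmem p (u, v)).1 (Finset.mem_product.2 ⟨hu, hv⟩)
    have hp' := Finset.HasAntidiagonal.mem_antidiagonal.1 hp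
    exact ncard_nappeSet_blockSizes_eq u v (by simp only at h; omega)
  · intro p _ p' _ hne
    rw [Function.onFun, Finset.disjoint_left]
    intro w h h'
    rw [hmem] at h h'
    exact hne (Prod.ext (h.1.1.symm.trans h'.1.1) (h.2.symm.trans h'.2))
  · intro w _
    refine (Set.finite_range fun x : Equiv.Perm (Fin (m + 2)) × Fin (m + 2) × Fin (m + 2) =>
      nappeSet x.1 x.2.1 x.2.2).subset ?_
    rintro _ ⟨σ, i, j, -, -, -, rfl⟩
    exact ⟨(σ, i, j), rfl⟩
  · intro w _ w' _ hne
    rw [Function.onFun, Set.disjoint_left]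
    rintro _ ⟨σ, i, j, hij, hσ, hb, rfl⟩ ⟨σ', i', j', hij', hσ', hb', h⟩
    rw [blockSizes_eq_of_nappeSet_eq hij hσ hij' hσ' h, hb'] at hb
    exact hne hb.symm

theorem card_antidiagonalTuple_four (m : ℕ) :
    (Finset.Nat.antidiagonalTuple 4 m).card = (3 + m).choose 3 := by
  have h := Finset.card_finsuppAntidiag_nat_eq_choose (s := (Finset.univ : Finset (Fin 4))) m
  rw [Finset.finsuppAntidiag, Finset.card_map, Finset.card_attach,
    Finset.piAntidiag_univ_fin_eq_antidiagonalTuple, Finset.card_fin] at h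
  rw [h, show 4 + m - 1 = 3 + m by omega, Nat.choose_symm_add]

theorem mk_card_antidiagonalTuple_four :
    (PowerSeries.mk fun m => ((Finset.Nat.antidiagonalTuple 4 m).card : ℚ))
      = ((1 - PowerSeries.X) ^ 4)⁻¹ := by
  rw [PowerSeries.eq_inv_iff_mul_eq_one (by simp)]
  simp_rw [card_antidiagonalTuple_four]
  rw [← PowerSeries.mk_one_pow_eq_mk_choose_add, ← mul_pow,
    PowerSeries.mk_one_mul_one_sub_eq_one, one_pow]

/-- When nothing lies inside the rectangle, the labels of the rows and those of the columns are
arbitrary words in two letters. -/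
theorem sum_labellingCount_of_eq_zero (m : ℕ) :
    ∑ u ∈ Finset.Nat.antidiagonalTuple 5 m with u 0 = 0, labellingCount u
      = ∑ p ∈ Finset.HasAntidiagonal.antidiagonal m, 2 ^ p.1 * 2 ^ p.2 := by
  have hpow : ∀ k : ℕ,
      2 ^ k = ∑ p ∈ Finset.HasAntidiagonal.antidiagonal k, (p.1 + p.2).choose p.1 := by
    intro k
    rw [← Nat.sum_range_choose, Finset.Nat.sum_antidiagonal_eq_sum_range_succ_mk]
    exact Finset.sum_congr rfl fun x hx => by
      rw [Nat.add_sub_cancel' (Finset.mem_range_succ_iff.1 hx)]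
  simp_rw [hpow, Finset.sum_mul_sum, ← Finset.sum_product', Finset.sum_sigma']
  symm
  refine Finset.sum_nbij' (fun x => ![0, x.2.1.1, x.2.1.2, x.2.2.1, x.2.2.2])
    (fun u => ⟨(u 1 + u 2, u 3 + u 4), ((u 1, u 2), (u 3, u 4))⟩) ?_ ?_ ?_ ?_ ?_
  · rintro ⟨⟨a, b⟩, ⟨c, d⟩, e, f⟩ h
    simp [Finset.Nat.mem_antidiagonalTuple, Fin.sum_univ_five] at h ⊢
    omega
  · intro u h
    simp [Finset.Nat.mem_antidiagonalTuple, Fin.sum_univ_five] at h ⊢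
    omega
  · rintro ⟨⟨a, b⟩, ⟨c, d⟩, e, f⟩ h
    simp at h ⊢
    obtain ⟨-, rfl, rfl⟩ := h
    simp
  · intro u h
    simp at h
    funext x
    fin_cases x <;> simp [h.2]
  · rintro ⟨⟨a, b⟩, ⟨c, d⟩, e, f⟩ h
    simp [labellingCount]

theorem mk_two_pow_eq_inv :
    (PowerSeries.mk fun m => ((2 : ℚ) ^ m)) = (1 - 2 * PowerSeries.X)⁻¹ := by
  rw [PowerSeries.eq_inv_iff_mul_eq_one (by simp)]
  ext m
  rw [mul_sub, mul_one, ← mul_assoc, mul_comm _ (2 : PowerSeries ℚ), mul_assoc]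
  have h2 : (2 : PowerSeries ℚ) = PowerSeries.C 2 := (map_ofNat PowerSeries.C 2).symm
  rw [h2, map_sub, PowerSeries.coeff_C_mul]
  cases m with
  | zero => simp
  | succ m => simp [PowerSeries.coeff_one, pow_succ, mul_comm]

theorem mk_sum_labellingCount_of_eq_zero :
    (PowerSeries.mk fun m =>
      ((∑ u ∈ Finset.Nat.antidiagonalTuple 5 m with u 0 = 0, labellingCount u : ℕ) : ℚ))
      = ((1 - 2 * PowerSeries.X) ^ 2)⁻¹ := by
  rw [pow_two, PowerSeries.mul_inv_rev, ← mk_two_pow_eq_inv]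
  ext m
  rw [PowerSeries.coeff_mul, PowerSeries.coeff_mk, sum_labellingCount_of_eq_zero]
  simp

/-- The generating function of the numbers of sets of removed join-irreducibles for which the block
sizes satisfy `Q`. -/
theorem mk_ncard_nappeSet_eq (N : ℕ → ℕ) (Q : (Fin 5 → ℕ) → Prop) [DecidablePred Q]
    (hN : ∀ n, N n = {S : Set (HFM n) | ∃ (σ : Equiv.Perm (Fin n)) (i j : Fin n),
      i < j ∧ σ j < σ i ∧ Q (blockSizes σ i j).1 ∧ S = nappeSet σ i j}.ncard) :
    (PowerSeries.mk fun n => (if 1 ≤ n then (N n : ℚ) else 0)) =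
      PowerSeries.X ^ 2 * ((1 - PowerSeries.X) ^ 4)⁻¹ * PowerSeries.mk fun m =>
        ((∑ u ∈ Finset.Nat.antidiagonalTuple 5 m with Q u, labellingCount u : ℕ) : ℚ) := by
  ext n
  rw [mul_assoc, PowerSeries.coeff_X_pow_mul', PowerSeries.coeff_mk]
  rcases Nat.lt_or_ge n 2 with hn | hn
  · -- There are no inversions for `n < 2`.
    rw [if_neg (not_le.2 hn)]
    have : N n = 0 := by
      rw [hN, ← Set.ncard_empty (Set (HFM n))]
      congr 1
      rw [Set.eq_empty_iff_forall_notMem]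
      rintro _ ⟨σ, i, j, hij, -⟩
      rw [Fin.lt_def] at hij
      omega
    simp [this]
  · obtain ⟨m, rfl⟩ := Nat.exists_eq_add_of_le' hn
    rw [if_pos (by omega), if_pos hn, hN, ncard_nappeSet_eq_sum, Nat.add_sub_cancel,
      ← mk_card_antidiagonalTuple_four, mul_comm, PowerSeries.coeff_mul]
    push_cast
    simp

end Series

/-- A cover of the Bruhat order is an inversion with an empty rectangle. -/
theorem bruhatCovBy_mul_swap_iff_blockSizes {n : ℕ} {σ : Equiv.Perm (Fin n)} {i j : Fin n}
    (hij : i < j) : BruhatCovBy (σ * Equiv.swap i j) σ ↔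
      σ j < σ i ∧ (blockSizes σ i j).1 0 = 0 := by
  rw [bruhatCovBy_mul_swap_iff hij]
  simp [blockSizes, innerRows, Finset.filter_eq_empty_iff]

theorem mainTheorem10 :
    (PowerSeries.mk fun n => (if 1 ≤ n then (numN n : ℚ) else 0)) =
        (PowerSeries.X : PowerSeries ℚ) ^ 2 * ((1 - PowerSeries.X) ^ 4)⁻¹ * factorialSeries ∧
    (PowerSeries.mk fun n => (if 1 ≤ n then (numO n : ℚ) else 0)) =
        (PowerSeries.X : PowerSeries ℚ) ^ 2 *
          ((1 - PowerSeries.X) ^ 4 * (1 - 2 * PowerSeries.X) ^ 2)⁻¹ := by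
  constructor
  · rw [mk_ncard_nappeSet_eq numN (fun _ => True)]
    · congr 1
      ext m
      simp [factorialSeries, cast_labellingCount]
    · intro n
      rw [numN]
      congr 1
      ext S
      refine exists_congr fun σ => exists_congr fun i => exists_congr fun j =>
        and_congr_right fun hij => ?_
      rw [bruhatLT_mul_swap_iff hij, true_and]
  · rw [mk_ncard_nappeSet_eq numO (fun u => u 0 = 0), mk_sum_labellingCount_of_eq_zero,
      PowerSeries.mul_inv_rev, mul_assoc, mul_comm ((1 - 2 * PowerSeries.X) ^ 2)⁻¹]
    intro n
    rw [numO]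
    congr 1
    ext S
    refine exists_congr fun σ => exists_congr fun i => exists_congr fun j =>
      and_congr_right fun hij => ?_
    rw [bruhatCovBy_mul_swap_iff_blockSizes hij, and_assoc]
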